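/- Let $\mathbb{D}=\{z\in\mathbb{C}:|z|<1\}$, $\mathbb{N}=\{1,2,\dots\}$ and $\mathbb{N}_0=\mathbb{N}\cup\{0\}$. For a doubly indexed family $X_{n,N}$ in a topological space and $s\ge 0$, write $\lim_{n/N\to s}X_{n,N}=X$ if $\lim_{j\to\infty}X_{n_j,N_j}=X$ for all sequences $n_j,N_j\in\mathbb{N}$ with $n_j\to\infty$, $N_j\to\infty$ and $n_j/N_j\to s$. Given $\{\alpha_{n,N}\mid n,N\in\mathbb{N}_0\}\subset\mathbb{D}$, define for each $N$ the monic polynomials $\Phi_{n,N}$ of degree $n$ by $\Phi_{0,N}=1$ and $$\Phi_{n+1,N}(z)=z\,\Phi_{n,N}(z)-\overline{\alpha_{n,N}}\,\Phi_{n,N}^{*}(z),\qquad \Phi_{n,N}^{*}(z)=z^{n}\,\overline{\Phi_{n,N}(1/\bar z)},\qquad n\ge 0,$$ and, for $|\beta|=1$, the paraorthogonal polynomials $$\Phi^{(\beta)}_{n+1,N}(z)=z\,\Phi_{n,N}(z)-\bar\beta\,\Phi^{*}_{n,N}(z),\qquad n\ge 0.$$ For $n\ge1$ let $\nu^{(\beta)}_{n,N}=\frac1n\sum_{j=1}^{n}\delta_{z_j}$,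 where $z_1,\dots,z_n$ are the zeros of $\Phi^{(\beta)}_{n,N}$ counted with multiplicity. For $0\le a<1$ put $\theta_a=2\arcsin a$ and let $\nu_a$ be the measure on the arc $\Gamma_a=\{e^{i\theta}\mid\theta_a\le\theta\le2\pi-\theta_a\}$ with $$\frac{d\nu_a}{d\theta}(e^{i\theta})=\frac1{2\pi}\,\frac{\sin(\theta/2)}{\sqrt{\cos^2(\theta_a/2)-\cos^2(\theta/2)}},\qquad \theta_a<\theta<2\pi-\theta_a,$$ and let $\nu_1=\delta_{-1}$. Theorem. Let $t>0$, let $\alpha:[0,t]\to\overline{\mathbb{D}}$ be Lebesgue measurable, and let $\{\alpha_{n,N}\mid n,N\in\mathbb{N}_0\}\subset\mathbb{D}$ satisfy $$\lim_{n/N\to s}\alpha_{n,N}=\alpha(s)\qquad\text{for a.e. } s\in[0,t].$$ Then the average $\sigma_t=\frac1t\int_0^t\nu_{|\alpha(s)|}\,ds$, that is, $\sigma_t(B)=\frac1t\int_0^t\nu_{|\alpha(s)|}(B)\,ds$ for Borel sets $B\subseteq\mathbb{C}$, is a well-defined probability measure, and for every $\beta\in\mathbb{C}$ with $|\beta|=1$,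 $$\lim_{n/N\to t}\nu^{(\beta)}_{n,N}=\sigma_t$$ in the weak topology of finite measures on $\mathbb{C}$, i.e. tested against bounded continuous functions. -/

import Mathlib

open MeasureTheory Filter Topology Polynomial
open scoped NNReal ENNReal

noncomputable section

namespace VaryingPOPUC

/-- `lim_{n/N → t} X_{n,N} = L`: the limit is `L` along all sequences `n_j, N_j → ∞` of naturals
with `n_j / N_j → t`. -/
def RatioTendsto {E : Type*} [TopologicalSpace E] (X : ℕ → ℕ → E) (t : ℝ) (L : E) : Prop :=
  ∀ n N : ℕ → ℕ, Tendsto n atTop atTop → Tendsto N atTop atTop →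
    Tendsto (fun j => (n j : ℝ) / (N j : ℝ)) atTop (𝓝 t) →
    Tendsto (fun j => X (n j) (N j)) atTop (𝓝 L)

/-- The reversed polynomial `z ^ n * conj (p (1 / conj z))` of a polynomial `p` of degree at
most `n`: the `k`-th coefficient is the conjugate of the `(n - k)`-th coefficient of `p`. -/
def revPoly (n : ℕ) (p : ℂ[X]) : ℂ[X] :=
  (p.map (starRingEnd ℂ)).reflect n

/-- The monic orthogonal polynomials on the unit circle with Verblunsky coefficients `a`,
generated by the Szegő recurrence. -/
def opuc (a : ℕ → ℂ) : ℕ → ℂ[X]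
  | 0 => 1
  | n + 1 => X * opuc a n - C (starRingEnd ℂ (a n)) * revPoly n (opuc a n)

/-- The paraorthogonal polynomials with Verblunsky coefficients `a` and parameter `β`. -/
def popuc (a : ℕ → ℂ) (β : ℂ) : ℕ → ℂ[X]
  | 0 => 1
  | n + 1 => X * opuc a n - C (starRingEnd ℂ β) * revPoly n (opuc a n)

/-- The unit mass at `z`. -/
def diracMass (z : ℂ) : FiniteMeasure ℂ :=
  ⟨Measure.dirac z, inferInstance⟩

/-- The zero-counting measure `(1 / n) ∑ δ_{z_j}` of the `n`-th paraorthogonal polynomial,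
the sum running over its zeros with multiplicity. -/
def popucZeroMeasure (a : ℕ → ℂ) (β : ℂ) (n : ℕ) : FiniteMeasure ℂ :=
  (n : ℝ≥0)⁻¹ • ((popuc a β n).roots.map diracMass).sum

/-- The angle `θ_a = 2 arcsin a`. -/
def arcAngle (a : ℝ) : ℝ := 2 * Real.arcsin a

/-- The density of `ν_a` with respect to `dθ` on `[θ_a, 2π - θ_a]`, for `0 ≤ a < 1`. -/
def arcDensity (a θ : ℝ) : ℝ :=
  1 / (2 * Real.pi) *
    (Real.sin (θ / 2) / √(Real.cos (arcAngle a / 2) ^ 2 - Real.cos (θ / 2) ^ 2))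

/-- The measure `ν_a`, `0 ≤ a ≤ 1`, on the arc `Γ_a = {e^{iθ} : θ_a ≤ θ ≤ 2π - θ_a}`, as a
measure on `ℂ`; for `a = 1` it is the unit mass at `-1`. -/
def arcMeasure (a : ℝ) : Measure ℂ :=
  if a = 1 then Measure.dirac (-1)
  else Measure.map (fun θ : ℝ => Complex.exp (θ * Complex.I))
    ((volume.restrict (Set.Icc (arcAngle a) (2 * Real.pi - arcAngle a))).withDensity
      (fun θ => ENNReal.ofReal (arcDensity a θ)))

/-- The average `(1 / t) ∫_0^t ν_{|α(s)|} ds`, i.e. the measure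
`B ↦ (1 / t) ∫_0^t ν_{|α(s)|}(B) ds`. -/
def averageArcMeasure (t : ℝ) (α : ℝ → ℂ) : Measure ℂ :=
  ENNReal.ofReal t⁻¹ •
    Measure.bind (volume.restrict (Set.Icc 0 t)) (fun s => arcMeasure ‖α s‖)

end VaryingPOPUC

end

/-
Idea. If `z_j` are the zeros of `Φ_n`, then `Φ_n^* = ∏ (1 - conj z_j * X)`, so the power sums of
the `conj z_j` are the Taylor coefficients of minus the logarithmic derivative of `Φ_n^*`. The
recurrence `Φ_{n+1}^* = Φ_n^* (1 - α_n X f_n)` with `f_n = Φ_n / Φ_n^*` turns them into sums over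
`k < n` of the coefficients of `-(log (1 - α_k X f_k))'`. These are bounded uniformly in all the
parameters and, when `k / N → s`, converge to their value for constant Verblunsky coefficients
`α(s)`, which is a moment of `ν_{|α(s)|}`. By dominated convergence, the normalized power sums
converge to the moments of `σ_t`, and on the unit circle the moments determine weak limits. A
paraorthogonal polynomial is an orthogonal polynomial with last coefficient `β`; this last step
changes the normalized power sums only by `O(1 / n)`.
-/

noncomputable section

namespace VaryingPOPUC

open scoped ComplexConjugate PowerSeries

local notation "𝕏" => PowerSeries.X
local notation "𝕔" => PowerSeries.C

section SzegoRecurrence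

lemma natDegree_revPoly_le {n : ℕ} {p : ℂ[X]} (hp : p.natDegree ≤ n) :
    (revPoly n p).natDegree ≤ n :=
  natDegree_reflect_le.trans (max_le le_rfl (natDegree_map_le.trans hp))

lemma revPoly_sub (n : ℕ) (p q : ℂ[X]) : revPoly n (p - q) = revPoly n p - revPoly n q := by
  simp only [revPoly, Polynomial.map_sub, reflect_sub]

lemma revPoly_C_mul (n : ℕ) (c : ℂ) (p : ℂ[X]) :
    revPoly n (C c * p) = C (conj c) * revPoly n p := by
  simp only [revPoly, Polynomial.map_mul, map_C, reflect_C_mul]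

lemma revPoly_revPoly (n : ℕ) (p : ℂ[X]) : revPoly n (revPoly n p) = p := by
  ext k
  simp [revPoly, coeff_reflect]

lemma revPoly_succ {n : ℕ} {p : ℂ[X]} (hp : p.natDegree ≤ n) :
    revPoly (n + 1) p = X * revPoly n p := by
  simpa [revPoly, add_comm] using
    reflect_mul (1 : ℂ[X]) (p.map conj) (F := 1) (by simp) (natDegree_map_le.trans hp)

lemma revPoly_X_mul {n : ℕ} {p : ℂ[X]} (hp : p.natDegree ≤ n) :
    revPoly (n + 1) (X * p) = revPoly n p := by
  simpa [revPoly, add_comm] using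
    reflect_mul (X : ℂ[X]) (p.map conj) (F := 1) natDegree_X_le (natDegree_map_le.trans hp)

lemma revPoly_szego {n : ℕ} {p : ℂ[X]} (hp : p.natDegree ≤ n) (c : ℂ) :
    revPoly (n + 1) (X * p - C (conj c) * revPoly n p) = revPoly n p - C c * (X * p) := by
  rw [revPoly_sub, revPoly_X_mul hp, revPoly_C_mul, revPoly_succ (natDegree_revPoly_le hp),
    revPoly_revPoly, Complex.conj_conj]

/-- The reversed polynomial `Φ_n^*` of the orthogonal polynomial `Φ_n`. -/
def opucStar (a : ℕ → ℂ) (n : ℕ) : ℂ[X] := revPoly n (opuc a n)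

lemma opuc_succ (a : ℕ → ℂ) (n : ℕ) :
    opuc a (n + 1) = X * opuc a n - C (conj (a n)) * opucStar a n := rfl

@[simp] lemma opuc_zero (a : ℕ → ℂ) : opuc a 0 = 1 := rfl

@[simp] lemma opucStar_zero (a : ℕ → ℂ) : opucStar a 0 = 1 := by
  simp [opucStar, revPoly]

lemma monic_opuc_and_natDegree_opuc (a : ℕ → ℂ) (n : ℕ) :
    (opuc a n).Monic ∧ (opuc a n).natDegree = n := by
  induction n with
  | zero => simp
  | succ n ih =>
    obtain ⟨hmonic, hdeg⟩ := ih
    have hX : (X * opuc a n).natDegree = n + 1 := by rw [natDegree_X_mul hmonic.ne_zero, hdeg]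
    have hlt : (C (conj (a n)) * opucStar a n).degree < (X * opuc a n).degree := by
      refine degree_lt_degree ?_
      rw [hX, Nat.lt_succ_iff]
      exact (natDegree_C_mul_le _ _).trans (natDegree_revPoly_le hdeg.le)
    rw [opuc_succ]
    refine ⟨(monic_X.mul hmonic).sub_of_left hlt, ?_⟩
    rw [natDegree_eq_of_degree_eq (degree_sub_eq_left_of_degree_lt hlt), hX]

lemma monic_opuc (a : ℕ → ℂ) (n : ℕ) : (opuc a n).Monic :=
  (monic_opuc_and_natDegree_opuc a n).1

lemma natDegree_opuc (a : ℕ → ℂ) (n : ℕ) : (opuc a n).natDegree = n :=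
  (monic_opuc_and_natDegree_opuc a n).2

lemma opucStar_succ (a : ℕ → ℂ) (n : ℕ) :
    opucStar a (n + 1) = opucStar a n - C (a n) * (X * opuc a n) :=
  revPoly_szego (natDegree_opuc a n).le (a n)

lemma opuc_congr {a b : ℕ → ℂ} {n : ℕ} (h : ∀ k < n, a k = b k) : opuc a n = opuc b n := by
  induction n with
  | zero => rfl
  | succ n ih =>
    rw [opuc, opuc, ih fun k hk => h k (hk.trans n.lt_succ_self), h n n.lt_succ_self]

lemma popuc_eq_opuc (a : ℕ → ℂ) (β : ℂ) (n : ℕ) :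
    popuc a β n = opuc (Function.update a (n - 1) β) n := by
  cases n with
  | zero => rfl
  | succ n =>
    have h : opuc a n = opuc (Function.update a n β) n :=
      opuc_congr fun k hk => (Function.update_of_ne hk.ne _ _).symm
    rw [popuc, opuc, Nat.add_sub_cancel, Function.update_self, ← h]

end SzegoRecurrence

section Zeros

lemma norm_sub_mul_sq_sub_norm_sub_conj_mul_sq (x y c : ℂ) :
    ‖y - c * x‖ ^ 2 - ‖x - conj c * y‖ ^ 2 = (1 - ‖c‖ ^ 2) * (‖y‖ ^ 2 - ‖x‖ ^ 2) := by
  simp only [← Complex.normSq_eq_norm_sq, Complex.normSq_apply, Complex.sub_re, Complex.sub_im,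
    Complex.mul_re, Complex.mul_im, Complex.conj_re, Complex.conj_im]
  ring

lemma eval_opucStar_ne_zero_and_norm_eval_opuc_le {a : ℕ → ℂ} {n : ℕ} (ha : ∀ k < n, ‖a k‖ ≤ 1)
    {z : ℂ} (hz : ‖z‖ < 1) :
    (opucStar a n).eval z ≠ 0 ∧ ‖(opuc a n).eval z‖ ≤ ‖(opucStar a n).eval z‖ := by
  induction n with
  | zero => simp
  | succ n ih =>
    obtain ⟨h0, hle⟩ := ih fun k hk => ha k (hk.trans n.lt_succ_self)
    have han := ha n n.lt_succ_self
    simp only [opucStar_succ, opuc_succ, eval_sub, eval_mul, eval_C, eval_X]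
    set x := (opuc a n).eval z
    set y := (opucStar a n).eval z
    have hzx : ‖z * x‖ < ‖y‖ := by
      rw [norm_mul]
      exact (mul_le_mul_of_nonneg_left hle (norm_nonneg z)).trans_lt
        (mul_lt_of_lt_one_left (norm_pos_iff.2 h0) hz)
    constructor
    · refine fun h => hzx.not_ge ?_
      rw [sub_eq_zero.1 h, norm_mul]
      exact mul_le_of_le_one_left (norm_nonneg _) han
    · refine le_of_sq_le_sq (sub_nonneg.1 ?_) (norm_nonneg _)
      rw [norm_sub_mul_sq_sub_norm_sub_conj_mul_sq]
      exact mul_nonneg (sub_nonneg.2 (pow_le_one₀ (norm_nonneg _) han))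
        (sub_nonneg.2 (pow_le_pow_left₀ (norm_nonneg _) hzx.le 2))

lemma isRoot_revPoly_iff {n : ℕ} {p : ℂ[X]} (hp : p.natDegree ≤ n) {z : ℂ} (hz : z ≠ 0) :
    (revPoly n p).IsRoot z ↔ p.IsRoot (conj z)⁻¹ := by
  let := invertibleOfNonzero (inv_ne_zero hz)
  have h := eval₂_reflect_eq_zero_iff (RingHom.id ℂ) z⁻¹ n (p.map conj) (natDegree_map_le.trans hp)
  rw [invOf_eq_inv, inv_inv] at h
  rw [IsRoot, IsRoot, revPoly, ← eval₂_id, h, eval₂_id, eval_map, ← map_inv₀,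
    ← map_eq_zero (starRingEnd ℂ) (a := eval _ p), ← eval₂_at_apply, Complex.conj_conj]

lemma opucStar_succ_eq_C_mul_opuc {a : ℕ → ℂ} {n : ℕ} (hn : ‖a n‖ = 1) :
    opucStar a (n + 1) = C (-a n) * opuc a (n + 1) := by
  have h : C (a n) * C (conj (a n)) = 1 := by
    rw [← C_mul, Complex.mul_conj, Complex.normSq_eq_norm_sq, hn]; simp
  rw [opucStar_succ, opuc_succ, C_neg]
  linear_combination (-opucStar a n) * h

lemma norm_eq_one_of_isRoot_opuc {a : ℕ → ℂ} {n : ℕ} (ha : ∀ k < n, ‖a k‖ ≤ 1) (hn : ‖a n‖ = 1)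
    {z : ℂ} (hz : (opuc a (n + 1)).IsRoot z) : ‖z‖ = 1 := by
  have ha' : ∀ k < n + 1, ‖a k‖ ≤ 1 := fun k hk =>
    (Nat.lt_succ_iff_lt_or_eq.1 hk).elim (ha k) fun h => h ▸ hn.le
  have star_isRoot : ∀ w, (opuc a (n + 1)).IsRoot w → (opucStar a (n + 1)).IsRoot w := by
    intro w hw
    rw [opucStar_succ_eq_C_mul_opuc hn]
    exact hw.dvd (dvd_mul_left _ _)
  have not_isRoot : ∀ w, ‖w‖ < 1 → ¬(opuc a (n + 1)).IsRoot w := fun w hw hroot =>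
    (eval_opucStar_ne_zero_and_norm_eval_opuc_le ha' hw).1 (star_isRoot w hroot)
  refine le_antisymm (not_lt.1 fun h => ?_) (not_lt.1 fun h => not_isRoot z h hz)
  have hz0 : z ≠ 0 := norm_pos_iff.1 (zero_lt_one.trans h)
  refine not_isRoot (conj z)⁻¹ ?_
    ((isRoot_revPoly_iff (natDegree_opuc a _).le hz0).1 (star_isRoot z hz))
  rw [norm_inv, RCLike.norm_conj]
  exact inv_lt_one_of_one_lt₀ h

lemma card_roots_opuc (a : ℕ → ℂ) (n : ℕ) : (opuc a n).roots.card = n := by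
  rw [IsAlgClosed.card_roots_eq_natDegree, natDegree_opuc]

lemma reverse_prod_X_sub_C {R : Type*} [CommRing R] [IsDomain R] (s : Multiset R) :
    (s.map fun z => X - C z).prod.reverse = (s.map fun z => 1 - C z * X).prod := by
  induction s using Multiset.induction_on with
  | empty => simpa using reverse_C (1 : R)
  | cons z s ih =>
    have h : (X - C z).reverse = 1 - C z * X := by
      rw [reverse, natDegree_X_sub_C, reflect_sub, reflect_one_X, reflect_C, pow_one]
    simp only [Multiset.map_cons, Multiset.prod_cons, reverse_mul_of_domain, ih, h]

lemma opucStar_eq_prod (a : ℕ → ℂ) (n : ℕ) :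
    opucStar a n = (((opuc a n).roots.map conj).map fun z => 1 - C z * X).prod := by
  have hprod : opuc a n = ((opuc a n).roots.map fun z => X - C z).prod :=
    (prod_multiset_X_sub_C_of_monic_of_roots_card_eq (monic_opuc a n)
      (by rw [card_roots_opuc, natDegree_opuc])).symm
  have hmap : (opuc a n).map conj =
      (((opuc a n).roots.map conj).map fun z => X - C z).prod := by
    conv_lhs => rw [hprod]
    simp [Polynomial.map_multiset_prod, Multiset.map_map]
  have hdeg : ((opuc a n).map conj).natDegree = n := by rw [natDegree_map, natDegree_opuc]
  rw [← reverse_prod_X_sub_C, ← hmap, reverse, hdeg, opucStar, revPoly]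

end Zeros

section LogDerivative

lemma mk_pow_mul_one_sub {R : Type*} [CommRing R] (c : R) :
    PowerSeries.mk (c ^ ·) * (1 - 𝕔 c * 𝕏) = 1 := by
  simpa [PowerSeries.rescale_mk] using
    congrArg (PowerSeries.rescale c) (PowerSeries.mk_one_mul_one_sub_eq_one R)

lemma derivative_prod_one_sub {R : Type*} [CommRing R] (s : Multiset R) :
    d⁄dX R (s.map fun z => 1 - 𝕔 z * 𝕏).prod =
      -PowerSeries.mk (fun k => (s.map (· ^ (k + 1))).sum) *
        (s.map fun z => 1 - 𝕔 z * 𝕏).prod := by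
  induction s using Multiset.induction_on with
  | empty =>
    have h : PowerSeries.mk (fun _ : ℕ => (0 : R)) = 0 := rfl
    simp [h]
  | cons z s ih =>
    have hmk : PowerSeries.mk (fun k => z ^ (k + 1) + (s.map (· ^ (k + 1))).sum) =
        𝕔 z * PowerSeries.mk (z ^ ·) + PowerSeries.mk (fun k => (s.map (· ^ (k + 1))).sum) := by
      ext k
      simp [pow_succ']
    simp only [Multiset.map_cons, Multiset.prod_cons, Multiset.sum_cons, hmk,
      Derivation.leibniz, ih, smul_eq_mul, map_sub, Derivation.map_one_eq_zero,
      PowerSeries.derivative_C, PowerSeries.derivative_X]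
    linear_combination 𝕔 z * (s.map fun z => 1 - 𝕔 z * 𝕏).prod * mk_pow_mul_one_sub z

variable {K : Type*} [Field K]

/-- Minus the logarithmic derivative of the power series `1 - c X f`. It measures the contribution
of one step of the Szegő recurrence to the logarithmic derivative of `Φ_n^*`. -/
def stepLogDeriv (c : K) (f : K⟦X⟧) : K⟦X⟧ :=
  d⁄dX K (𝕔 c * (𝕏 * f)) * (1 - 𝕔 c * (𝕏 * f))⁻¹

lemma stepLogDeriv_mul (c : K) (f : K⟦X⟧) :
    stepLogDeriv c f * (1 - 𝕔 c * (𝕏 * f)) = d⁄dX K (𝕔 c * (𝕏 * f)) := by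
  rw [stepLogDeriv, mul_assoc, PowerSeries.inv_mul_cancel _ (by simp), mul_one]

lemma stepLogDeriv_eq (c : K) (f : K⟦X⟧) :
    stepLogDeriv c f = d⁄dX K (𝕔 c * (𝕏 * f)) + 𝕏 * (𝕔 c * (f * stepLogDeriv c f)) := by
  linear_combination stepLogDeriv_mul c f

lemma coeff_zero_stepLogDeriv (c : K) (f : K⟦X⟧) :
    PowerSeries.coeff 0 (stepLogDeriv c f) = c * PowerSeries.coeff 0 f := by
  rw [stepLogDeriv_eq]
  simp [mul_comm]

lemma coeff_succ_stepLogDeriv (c : K) (f : K⟦X⟧) (k : ℕ) :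
    PowerSeries.coeff (k + 1) (stepLogDeriv c f) =
      ((k + 2 : ℕ) : K) * (c * PowerSeries.coeff (k + 1) f) +
        c * PowerSeries.coeff k (f * stepLogDeriv c f) := by
  conv_lhs => rw [stepLogDeriv_eq]
  simp only [map_add, PowerSeries.coeff_derivative, PowerSeries.coeff_C_mul,
    PowerSeries.coeff_succ_X_mul]
  push_cast
  ring

end LogDerivative

section SchurRatio

/-- The Taylor series at the origin of the ratio `Φ_n / Φ_n^*`. -/
def schurRatio (a : ℕ → ℂ) (n : ℕ) : ℂ⟦X⟧ := (opuc a n : ℂ⟦X⟧) * (opucStar a n : ℂ⟦X⟧)⁻¹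

lemma coeff_zero_opucStar (a : ℕ → ℂ) (n : ℕ) : (opucStar a n).coeff 0 = 1 := by
  have h : (opuc a n).coeff n = 1 := by
    simpa [natDegree_opuc] using (monic_opuc a n).coeff_natDegree
  simp [opucStar, revPoly, coeff_reflect, h]

lemma coe_opucStar_ne_zero (a : ℕ → ℂ) (n : ℕ) : (opucStar a n : ℂ⟦X⟧) ≠ 0 := by
  intro h
  simpa [Polynomial.coe_eq_zero_iff.1 h] using coeff_zero_opucStar a n

lemma schurRatio_mul_opucStar (a : ℕ → ℂ) (n : ℕ) :
    schurRatio a n * (opucStar a n : ℂ⟦X⟧) = opuc a n := by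
  rw [schurRatio, mul_assoc, PowerSeries.inv_mul_cancel _ (by simp [coeff_zero_opucStar]),
    mul_one]

lemma coe_opucStar_succ (a : ℕ → ℂ) (n : ℕ) :
    (opucStar a (n + 1) : ℂ⟦X⟧) =
      (opucStar a n : ℂ⟦X⟧) * (1 - 𝕔 (a n) * (𝕏 * schurRatio a n)) := by
  rw [opucStar_succ]
  push_cast
  linear_combination (𝕔 (a n) * 𝕏) * schurRatio_mul_opucStar a n

lemma schurRatio_zero (a : ℕ → ℂ) : schurRatio a 0 = 1 := by
  simp [schurRatio]

lemma schurRatio_succ (a : ℕ → ℂ) (n : ℕ) :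
    schurRatio a (n + 1) = 𝕏 * schurRatio a n - 𝕔 (conj (a n)) +
      𝕏 * (𝕔 (a n) * (schurRatio a n * schurRatio a (n + 1))) := by
  refine mul_right_cancel₀ (coe_opucStar_ne_zero a n) ?_
  have h := schurRatio_mul_opucStar a (n + 1)
  rw [coe_opucStar_succ, opuc_succ] at h
  push_cast at h
  linear_combination h - 𝕏 * schurRatio_mul_opucStar a n

lemma coeff_zero_schurRatio_succ (a : ℕ → ℂ) (n : ℕ) :
    PowerSeries.coeff 0 (schurRatio a (n + 1)) = -conj (a n) := by
  rw [schurRatio_succ]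
  simp

lemma coeff_succ_schurRatio_succ (a : ℕ → ℂ) (n k : ℕ) :
    PowerSeries.coeff (k + 1) (schurRatio a (n + 1)) = PowerSeries.coeff k (schurRatio a n) +
      a n * PowerSeries.coeff k (schurRatio a n * schurRatio a (n + 1)) := by
  conv_lhs => rw [schurRatio_succ]
  simp [PowerSeries.coeff_succ_X_mul]

lemma derivative_opucStar (a : ℕ → ℂ) (n : ℕ) :
    d⁄dX ℂ (opucStar a n : ℂ⟦X⟧) =
      -(∑ i ∈ Finset.range n, stepLogDeriv (a i) (schurRatio a i)) *
        (opucStar a n : ℂ⟦X⟧) := by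
  induction n with
  | zero => simp
  | succ n ih =>
    rw [coe_opucStar_succ, Derivation.leibniz, ih, map_sub, ← stepLogDeriv_mul,
      Finset.sum_range_succ]
    simp only [smul_eq_mul, Derivation.map_one_eq_zero]
    ring

lemma sum_conj_pow_roots_opuc (a : ℕ → ℂ) (n k : ℕ) :
    ((opuc a n).roots.map fun z => conj z ^ (k + 1)).sum =
      ∑ i ∈ Finset.range n, PowerSeries.coeff k (stepLogDeriv (a i) (schurRatio a i)) := by
  have hprod : (opucStar a n : ℂ⟦X⟧) =
      (((opuc a n).roots.map conj).map fun z => 1 - 𝕔 z * 𝕏).prod := by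
    rw [opucStar_eq_prod, ← coeToPowerSeries.ringHom_apply, map_multiset_prod, Multiset.map_map,
      Multiset.map_map, Multiset.map_map]
    simp [Function.comp_def]
  have h := derivative_prod_one_sub ((opuc a n).roots.map conj)
  rw [← hprod, derivative_opucStar] at h
  have hcoeff := congrArg (PowerSeries.coeff k)
    (neg_injective (mul_right_cancel₀ (coe_opucStar_ne_zero a n) h))
  simpa [Multiset.map_map] using hcoeff.symm

end SchurRatio

section FixedPoint

variable {R : Type*} [CommRing R]

/-- The Taylor coefficients of `schurFixedPoint c d`. -/
def schurFixedPointCoeff (c d : R) : ℕ → R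
  | 0 => -d
  | k + 1 => schurFixedPointCoeff c d k +
      c * ∑ i : Fin (k + 1), schurFixedPointCoeff c d i * schurFixedPointCoeff c d (k - i)

/-- The power series `f` solving `f = X f - d + c X f ^ 2`. For `d = conj c` it is the fixed point
of the recursion of the ratios `Φ_n / Φ_n^*` for Verblunsky coefficients constantly equal to `c`. -/
def schurFixedPoint (c d : R) : R⟦X⟧ := PowerSeries.mk (schurFixedPointCoeff c d)

lemma coeff_zero_schurFixedPoint (c d : R) : PowerSeries.coeff 0 (schurFixedPoint c d) = -d := by
  simp [schurFixedPoint, schurFixedPointCoeff]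

lemma coeff_succ_schurFixedPoint (c d : R) (k : ℕ) :
    PowerSeries.coeff (k + 1) (schurFixedPoint c d) = PowerSeries.coeff k (schurFixedPoint c d) +
      c * PowerSeries.coeff k (schurFixedPoint c d * schurFixedPoint c d) := by
  simp only [schurFixedPoint, PowerSeries.coeff_mk, PowerSeries.coeff_mul, schurFixedPointCoeff]
  rw [Finset.Nat.sum_antidiagonal_eq_sum_range_succ
    fun i j => schurFixedPointCoeff c d i * schurFixedPointCoeff c d j, ← Fin.sum_univ_eq_sum_range
    fun i => schurFixedPointCoeff c d i * schurFixedPointCoeff c d (k - i)]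

lemma schurFixedPoint_eq (c d : R) :
    schurFixedPoint c d = 𝕏 * schurFixedPoint c d - 𝕔 d +
      𝕏 * (𝕔 c * (schurFixedPoint c d * schurFixedPoint c d)) := by
  ext k
  cases k with
  | zero => rw [coeff_zero_schurFixedPoint]; simp
  | succ k =>
    rw [coeff_succ_schurFixedPoint]
    simp [PowerSeries.coeff_succ_X_mul]

end FixedPoint

section Majorants

variable {A : Type*} [NormedRing A]

lemma norm_coeff_mul_le {f g : A⟦X⟧} {F G : ℝ⟦X⟧} {k : ℕ}
    (hf : ∀ m ≤ k, ‖PowerSeries.coeff m f‖ ≤ PowerSeries.coeff m F)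
    (hg : ∀ m ≤ k, ‖PowerSeries.coeff m g‖ ≤ PowerSeries.coeff m G) :
    ‖PowerSeries.coeff k (f * g)‖ ≤ PowerSeries.coeff k (F * G) := by
  simp only [PowerSeries.coeff_mul]
  refine norm_sum_le_of_le _ fun p hp => (norm_mul_le _ _).trans ?_
  have hfp := hf p.1 (Finset.HasAntidiagonal.antidiagonal.fst_le hp)
  have hgp := hg p.2 (Finset.HasAntidiagonal.antidiagonal.snd_le hp)
  exact mul_le_mul hfp hgp (norm_nonneg _) ((norm_nonneg _).trans hfp)

lemma norm_mul_le_of_norm_le_one {c x : A} {b : ℝ} (hc : ‖c‖ ≤ 1) (hx : ‖x‖ ≤ b) : ‖c * x‖ ≤ b :=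
  (norm_mul_le c x).trans ((mul_le_of_le_one_left (norm_nonneg x) hc).trans hx)

lemma norm_coeff_schurRatio_le {a : ℕ → ℂ} (ha : ∀ n, ‖a n‖ ≤ 1) (k n : ℕ) :
    ‖PowerSeries.coeff k (schurRatio a n)‖ ≤
      PowerSeries.coeff k (schurFixedPoint (1 : ℝ) (-1)) := by
  induction k using Nat.strong_induction_on generalizing n with
  | _ k ih =>
  cases k with
  | zero =>
    rw [coeff_zero_schurFixedPoint, neg_neg]
    cases n with
    | zero => simp [schurRatio_zero]
    | succ n => rw [coeff_zero_schurRatio_succ, norm_neg, RCLike.norm_conj]; exact ha n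
  | succ k =>
    have ih' (n : ℕ) : ∀ m ≤ k, ‖PowerSeries.coeff m (schurRatio a n)‖ ≤ _ := fun m hm =>
      ih m (Nat.lt_succ_of_le hm) n
    rw [coeff_succ_schurFixedPoint, one_mul]
    cases n with
    | zero =>
      rw [schurRatio_zero, PowerSeries.coeff_one, if_neg k.succ_ne_zero, norm_zero]
      exact add_nonneg ((norm_nonneg _).trans (ih' 0 k le_rfl))
        ((norm_nonneg _).trans (norm_coeff_mul_le (ih' 0) (ih' 0)))
    | succ n =>
      rw [coeff_succ_schurRatio_succ]
      exact norm_add_le_of_le (ih' n k le_rfl)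
        (norm_mul_le_of_norm_le_one (ha n) (norm_coeff_mul_le (ih' n) (ih' (n + 1))))

lemma norm_coeff_stepLogDeriv_le {c : ℂ} (hc : ‖c‖ ≤ 1)
    {f : ℂ⟦X⟧} {F : ℝ⟦X⟧} (hf : ∀ k, ‖PowerSeries.coeff k f‖ ≤ PowerSeries.coeff k F) (k : ℕ) :
    ‖PowerSeries.coeff k (stepLogDeriv c f)‖ ≤ PowerSeries.coeff k (stepLogDeriv 1 F) := by
  induction k using Nat.strong_induction_on with
  | _ k ih =>
  cases k with
  | zero =>
    rw [coeff_zero_stepLogDeriv, coeff_zero_stepLogDeriv, one_mul]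
    exact norm_mul_le_of_norm_le_one hc (hf 0)
  | succ k =>
    rw [coeff_succ_stepLogDeriv, coeff_succ_stepLogDeriv, one_mul, one_mul]
    refine norm_add_le_of_le ?_ (norm_mul_le_of_norm_le_one hc
      (norm_coeff_mul_le (fun m _ => hf m) fun m hm => ih m (Nat.lt_succ_of_le hm)))
    rw [norm_mul, Complex.norm_natCast]
    exact mul_le_mul_of_nonneg_left (norm_mul_le_of_norm_le_one hc (hf (k + 1)))
      (Nat.cast_nonneg _)

/-- A bound, uniform in the Verblunsky coefficients, for the `k`-th Taylor coefficients of the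
logarithmic derivatives of the steps of the Szegő recurrence. -/
def stepBound (k : ℕ) : ℝ :=
  PowerSeries.coeff k (stepLogDeriv 1 (schurFixedPoint (1 : ℝ) (-1)))

lemma norm_coeff_stepLogDeriv_schurRatio_le {a : ℕ → ℂ} (ha : ∀ n, ‖a n‖ ≤ 1) (k n : ℕ) :
    ‖PowerSeries.coeff k (stepLogDeriv (a n) (schurRatio a n))‖ ≤ stepBound k :=
  norm_coeff_stepLogDeriv_le (ha n) (fun m => norm_coeff_schurRatio_le ha m n) k

end Majorants

section RatioFilter

/-- The filter of pairs `(n, N)` with `n, N → ∞` and `n / N → s`. -/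
def ratioFilter (s : ℝ) : Filter (ℕ × ℕ) :=
  (atTop ×ˢ atTop) ⊓ comap (fun p => (p.1 : ℝ) / p.2) (𝓝 s)

instance (s : ℝ) : (ratioFilter s).IsCountablyGenerated := by
  unfold ratioFilter; infer_instance

lemma tendsto_ratioFilter_iff {ι : Type*} {l : Filter ι} {f : ι → ℕ × ℕ} {s : ℝ} :
    Tendsto f l (ratioFilter s) ↔ Tendsto (fun i => (f i).1) l atTop ∧
      Tendsto (fun i => (f i).2) l atTop ∧
      Tendsto (fun i => ((f i).1 : ℝ) / (f i).2) l (𝓝 s) := by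
  simp only [ratioFilter, tendsto_inf, tendsto_prod_iff', tendsto_comap_iff, Function.comp_def,
    and_assoc]

lemma ratioTendsto_iff_tendsto {E : Type*} [TopologicalSpace E] {x : ℕ → ℕ → E} {s : ℝ} {L : E} :
    RatioTendsto x s L ↔ Tendsto (fun p => x p.1 p.2) (ratioFilter s) (𝓝 L) := by
  rw [tendsto_iff_seq_tendsto]
  refine ⟨fun h u hu => ?_, fun h n N hn hN hnN => ?_⟩
  · obtain ⟨hn, hN, hnN⟩ := tendsto_ratioFilter_iff.1 hu
    exact h _ _ hn hN hnN
  · exact h (fun j => (n j, N j)) (tendsto_ratioFilter_iff.2 ⟨hn, hN, hnN⟩)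

variable {s : ℝ}

lemma tendsto_fst_ratioFilter : Tendsto Prod.fst (ratioFilter s) atTop :=
  (tendsto_ratioFilter_iff.1 tendsto_id).1

lemma tendsto_snd_ratioFilter : Tendsto Prod.snd (ratioFilter s) atTop :=
  (tendsto_ratioFilter_iff.1 tendsto_id).2.1

lemma tendsto_div_ratioFilter :
    Tendsto (fun p : ℕ × ℕ => (p.1 : ℝ) / p.2) (ratioFilter s) (𝓝 s) :=
  (tendsto_ratioFilter_iff.1 tendsto_id).2.2

lemma tendsto_inv_snd_ratioFilter :
    Tendsto (fun p : ℕ × ℕ => (p.2 : ℝ)⁻¹) (ratioFilter s) (𝓝 0) :=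
  tendsto_inv_atTop_nhds_zero_nat.comp tendsto_snd_ratioFilter

lemma tendsto_succ_ratioFilter :
    Tendsto (fun p : ℕ × ℕ => (p.1 + 1, p.2)) (ratioFilter s) (ratioFilter s) := by
  refine tendsto_ratioFilter_iff.2 ⟨(tendsto_add_atTop_nat 1).comp tendsto_fst_ratioFilter,
    tendsto_snd_ratioFilter, ?_⟩
  simpa [add_div] using tendsto_div_ratioFilter.add (tendsto_inv_snd_ratioFilter (s := s))

lemma tendsto_pred_ratioFilter :
    Tendsto (fun p : ℕ × ℕ => (p.1 - 1, p.2)) (ratioFilter s) (ratioFilter s) := by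
  refine tendsto_ratioFilter_iff.2 ⟨(tendsto_sub_atTop_nat 1).comp tendsto_fst_ratioFilter,
    tendsto_snd_ratioFilter, ?_⟩
  have h := tendsto_div_ratioFilter.sub (tendsto_inv_snd_ratioFilter (s := s))
  rw [sub_zero] at h
  refine h.congr' ?_
  filter_upwards [tendsto_fst_ratioFilter.eventually_ge_atTop 1] with p hp
  rw [Nat.cast_sub hp, Nat.cast_one, sub_div, one_div]

lemma tendsto_of_tendsto_comp_succ {E : Type*} {x : ℕ → ℕ → E} {l : Filter E}
    (h : Tendsto (fun p => x (p.1 + 1) p.2) (ratioFilter s) l) :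
    Tendsto (fun p => x p.1 p.2) (ratioFilter s) l := by
  refine (h.comp tendsto_pred_ratioFilter).congr' ?_
  filter_upwards [tendsto_fst_ratioFilter.eventually_ge_atTop 1] with p hp
  simp only [Function.comp_apply, Nat.sub_add_cancel hp]

lemma tendsto_floor_mul_fst_ratioFilter {t u : ℝ} (hu : 0 < u) :
    Tendsto (fun p : ℕ × ℕ => (⌊u * p.1⌋₊, p.2)) (ratioFilter t) (ratioFilter (u * t)) := by
  have hfst : Tendsto (fun p : ℕ × ℕ => (p.1 : ℝ)) (ratioFilter t) atTop :=
    tendsto_natCast_atTop_atTop.comp tendsto_fst_ratioFilter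
  refine tendsto_ratioFilter_iff.2 ⟨tendsto_nat_floor_atTop.comp (hfst.const_mul_atTop hu),
    tendsto_snd_ratioFilter, ?_⟩
  refine (((tendsto_nat_floor_mul_div_atTop hu.le).comp hfst).mul
    tendsto_div_ratioFilter).congr' ?_
  filter_upwards [tendsto_fst_ratioFilter.eventually_ge_atTop 1] with p hp
  have hp0 : (p.1 : ℝ) ≠ 0 := Nat.cast_ne_zero.2 (Nat.one_le_iff_ne_zero.1 hp)
  simp only [Function.comp_apply]
  rw [div_mul_div_cancel₀ hp0]

lemma tendsto_floor_mul_ratioFilter {s : ℝ} (hs : 0 < s) :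
    Tendsto (fun j : ℕ => (⌊s * j⌋₊, j)) atTop (ratioFilter s) := by
  have hdiag : Tendsto (fun j : ℕ => (j, j)) atTop (ratioFilter 1) := by
    refine tendsto_ratioFilter_iff.2 ⟨tendsto_id, tendsto_id, tendsto_const_nhds.congr' ?_⟩
    filter_upwards [eventually_ge_atTop 1] with j hj
    exact (div_self (Nat.cast_ne_zero.2 (Nat.one_le_iff_ne_zero.1 hj))).symm
  simpa only [mul_one, Function.comp_def] using (tendsto_floor_mul_fst_ratioFilter hs).comp hdiag

end RatioFilter

section StepLimits

lemma tendsto_coeff_mul {ι R : Type*} [Semiring R] [TopologicalSpace R] [IsTopologicalSemiring R]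
    {l : Filter ι} {f g : ι → R⟦X⟧} {f₀ g₀ : R⟦X⟧} {k : ℕ}
    (hf : ∀ m ≤ k, Tendsto (fun i => PowerSeries.coeff m (f i)) l (𝓝 (PowerSeries.coeff m f₀)))
    (hg : ∀ m ≤ k, Tendsto (fun i => PowerSeries.coeff m (g i)) l (𝓝 (PowerSeries.coeff m g₀))) :
    Tendsto (fun i => PowerSeries.coeff k (f i * g i)) l (𝓝 (PowerSeries.coeff k (f₀ * g₀))) := by
  simp only [PowerSeries.coeff_mul]
  exact tendsto_finsetSum _ fun p hp =>
    (hf p.1 (Finset.HasAntidiagonal.antidiagonal.fst_le hp)).mul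
      (hg p.2 (Finset.HasAntidiagonal.antidiagonal.snd_le hp))

lemma tendsto_coeff_stepLogDeriv {ι K : Type*} [Field K] [TopologicalSpace K]
    [IsTopologicalSemiring K] {l : Filter ι} {c : ι → K} {c₀ : K} (hc : Tendsto c l (𝓝 c₀))
    {f : ι → K⟦X⟧} {f₀ : K⟦X⟧}
    (hf : ∀ k, Tendsto (fun i => PowerSeries.coeff k (f i)) l (𝓝 (PowerSeries.coeff k f₀)))
    (k : ℕ) :
    Tendsto (fun i => PowerSeries.coeff k (stepLogDeriv (c i) (f i))) l
      (𝓝 (PowerSeries.coeff k (stepLogDeriv c₀ f₀))) := by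
  induction k using Nat.strong_induction_on with
  | _ k ih =>
  cases k with
  | zero =>
    simp only [coeff_zero_stepLogDeriv]
    exact hc.mul (hf 0)
  | succ k =>
    simp only [coeff_succ_stepLogDeriv]
    exact ((hc.mul (hf (k + 1))).const_mul _).add
      (hc.mul (tendsto_coeff_mul (fun m _ => hf m) fun m hm => ih m (Nat.lt_succ_of_le hm)))

lemma tendsto_coeff_schurRatio {A : ℕ → ℕ → ℂ} {s : ℝ} {c : ℂ} (hA : RatioTendsto A s c) (k : ℕ) :
    Tendsto (fun p : ℕ × ℕ => PowerSeries.coeff k (schurRatio (fun i => A i p.2) p.1))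
      (ratioFilter s) (𝓝 (PowerSeries.coeff k (schurFixedPoint c (conj c)))) := by
  have hA' := ratioTendsto_iff_tendsto.1 hA
  induction k using Nat.strong_induction_on with
  | _ k ih =>
  refine tendsto_of_tendsto_comp_succ
    (x := fun n N => PowerSeries.coeff k (schurRatio (fun i => A i N) n)) ?_
  cases k with
  | zero =>
    simp only [coeff_zero_schurRatio_succ, coeff_zero_schurFixedPoint]
    exact ((Complex.continuous_conj.tendsto c).comp hA').neg
  | succ k =>
    simp only [coeff_succ_schurRatio_succ, coeff_succ_schurFixedPoint]
    have ih' : ∀ m ≤ k, Tendsto (fun p : ℕ × ℕ =>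
        PowerSeries.coeff m (schurRatio (fun i => A i p.2) p.1)) (ratioFilter s)
        (𝓝 (PowerSeries.coeff m (schurFixedPoint c (conj c)))) :=
      fun m hm => ih m (Nat.lt_succ_of_le hm)
    have ih'' : ∀ m ≤ k, Tendsto (fun p : ℕ × ℕ =>
        PowerSeries.coeff m (schurRatio (fun i => A i p.2) (p.1 + 1))) (ratioFilter s)
        (𝓝 (PowerSeries.coeff m (schurFixedPoint c (conj c)))) := fun m hm => by
      simpa only [Function.comp_def] using (ih' m hm).comp tendsto_succ_ratioFilter
    exact (ih' k le_rfl).add (hA'.mul (tendsto_coeff_mul ih' ih''))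

lemma tendsto_coeff_stepLogDeriv_schurRatio {A : ℕ → ℕ → ℂ} {s : ℝ} {c : ℂ}
    (hA : RatioTendsto A s c) (k : ℕ) :
    Tendsto (fun p : ℕ × ℕ => PowerSeries.coeff k
      (stepLogDeriv (A p.1 p.2) (schurRatio (fun i => A i p.2) p.1))) (ratioFilter s)
      (𝓝 (PowerSeries.coeff k (stepLogDeriv c (schurFixedPoint c (conj c))))) :=
  tendsto_coeff_stepLogDeriv (ratioTendsto_iff_tendsto.1 hA) (tendsto_coeff_schurRatio hA) k

end StepLimits

section GeneratingFunction

lemma coeff_mul_subst {R : Type*} [CommRing R] (H F : R⟦X⟧) {g : R⟦X⟧}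
    (hg : PowerSeries.constantCoeff g = 0) (k : ℕ) :
    PowerSeries.coeff k (H * F.subst g) =
      ∑ m ∈ Finset.range (k + 1), PowerSeries.coeff m F * PowerSeries.coeff k (H * g ^ m) := by
  have hsubst : ∀ q ≤ k, PowerSeries.coeff q (F.subst g) =
      ∑ m ∈ Finset.range (k + 1), PowerSeries.coeff m F * PowerSeries.coeff q (g ^ m) := by
    intro q hq
    rw [PowerSeries.coeff_subst' (PowerSeries.HasSubst.of_constantCoeff_zero' hg)]
    refine finsum_eq_sum_of_support_subset _ fun m hm => ?_
    rw [Finset.coe_range, Set.mem_Iio]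
    by_contra hmk
    refine hm ?_
    have hdvd : 𝕏 ^ m ∣ g ^ m := pow_dvd_pow_of_dvd (PowerSeries.X_dvd_iff.2 hg) m
    simp only [PowerSeries.X_pow_dvd_iff.1 hdvd q (by omega), smul_zero]
  simp only [PowerSeries.coeff_mul, Finset.mul_sum]
  rw [Finset.sum_comm]
  refine Finset.sum_congr rfl fun p hp => ?_
  rw [hsubst p.2 (Finset.HasAntidiagonal.antidiagonal.snd_le hp), Finset.mul_sum]
  exact Finset.sum_congr rfl fun m _ => mul_left_comm _ _ _

variable {K : Type*} [Field K]

lemma one_add_X_mul_inv : (1 + 𝕏 : K⟦X⟧) * (1 + 𝕏)⁻¹ = 1 :=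
  PowerSeries.mul_inv_cancel _ (by simp)

/-- The Koebe function `X / (1 + X) ^ 2`. -/
def koebeSeries (K : Type*) [Field K] : K⟦X⟧ := 𝕏 * (1 + 𝕏)⁻¹ ^ 2

lemma constantCoeff_koebeSeries : PowerSeries.constantCoeff (koebeSeries K) = 0 := by
  simp [koebeSeries]

lemma koebeSeries_mul : koebeSeries K * (1 + 𝕏) ^ 2 = 𝕏 := by
  rw [koebeSeries, mul_assoc, ← mul_pow, mul_comm _ (1 + 𝕏), one_add_X_mul_inv, one_pow, mul_one]

/-- The series `(1 - X) / (1 + X) * F (X / (1 + X) ^ 2)`. If `F` is the moment generating function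
of `|1 + w| ^ 2` under a probability measure on the unit circle invariant under conjugation, then it
is `1 + 2 * ∑ k ≥ 1, (∫ w ^ k) X ^ k`. -/
def koebeTransform (F : K⟦X⟧) : K⟦X⟧ := (1 - 𝕏) * (1 + 𝕏)⁻¹ * F.subst (koebeSeries K)

/-- The matrix entries of `koebeTransform`, mapping the moments of `|1 + w| ^ 2` to trigonometric
moments. -/
def koebeCoeff (K : Type*) [Field K] (k m : ℕ) : K :=
  PowerSeries.coeff k ((1 - 𝕏) * (1 + 𝕏)⁻¹ * koebeSeries K ^ m)

lemma coeff_koebeTransform (F : K⟦X⟧) (k : ℕ) :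
    PowerSeries.coeff k (koebeTransform F) =
      ∑ m ∈ Finset.range (k + 1), PowerSeries.coeff m F * koebeCoeff K k m :=
  coeff_mul_subst _ F constantCoeff_koebeSeries k

lemma koebeTransform_mul_eq {F : K⟦X⟧} {q : K} (hF : F * (1 - 𝕔 q * 𝕏) = 1) :
    koebeTransform F * ((1 + 𝕏) ^ 2 - 𝕔 q * 𝕏) = (1 - 𝕏) * (1 + 𝕏) := by
  have hs := PowerSeries.HasSubst.of_constantCoeff_zero' (constantCoeff_koebeSeries (K := K))
  have hC (c : K) : (𝕔 c).subst (koebeSeries K) = 𝕔 c := PowerSeries.subst_C c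
  have h := congrArg (PowerSeries.subst (koebeSeries K)) hF
  rw [PowerSeries.subst_mul hs, PowerSeries.subst_sub hs, PowerSeries.subst_mul hs,
    PowerSeries.subst_X hs, ← map_one 𝕔, hC, hC, map_one] at h
  rw [koebeTransform]
  linear_combination (1 - 𝕏) * (1 + 𝕏) * h +
    (1 - 𝕏) * (1 + 𝕏) * F.subst (koebeSeries K) * (1 - 𝕔 q * koebeSeries K) *
      one_add_X_mul_inv (K := K) +
    (1 - 𝕏) * (1 + 𝕏)⁻¹ * F.subst (koebeSeries K) * 𝕔 q * koebeSeries_mul (K := K)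

lemma koebeTransform_sq (F : K⟦X⟧) :
    koebeTransform F ^ 2 * (1 + 𝕏) = (1 - 𝕏) * koebeTransform (F ^ 2) := by
  have hs := PowerSeries.HasSubst.of_constantCoeff_zero' (constantCoeff_koebeSeries (K := K))
  rw [koebeTransform, koebeTransform, PowerSeries.subst_pow hs]
  linear_combination (1 - 𝕏) ^ 2 * (1 + 𝕏)⁻¹ * F.subst (koebeSeries K) ^ 2 *
    one_add_X_mul_inv (K := K)

lemma pow_add_pow_eq_sum_koebeCoeff {w v : K} (hwv : w * v = 1) (k : ℕ) :
    w ^ (k + 1) + v ^ (k + 1) =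
      ∑ m ∈ Finset.range (k + 2), (2 + w + v) ^ m * koebeCoeff K (k + 1) m := by
  have hC : 𝕔 w * 𝕔 v = 1 := by rw [← map_mul, hwv, map_one]
  have hfac : (1 + 𝕏) ^ 2 - 𝕔 (2 + w + v) * 𝕏 = (1 - 𝕔 w * 𝕏) * (1 - 𝕔 v * 𝕏) := by
    rw [map_add, map_add, map_ofNat]
    linear_combination -𝕏 ^ 2 * hC
  have hne : (1 + 𝕏) ^ 2 - 𝕔 (2 + w + v) * 𝕏 ≠ 0 := by
    intro h0
    simpa using congrArg (PowerSeries.coeff 0) h0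
  have hK : koebeTransform (PowerSeries.mk ((2 + w + v) ^ ·)) =
      PowerSeries.mk (w ^ ·) + PowerSeries.mk (v ^ ·) - 1 := by
    refine mul_right_cancel₀ hne ?_
    rw [koebeTransform_mul_eq (mk_pow_mul_one_sub _), hfac]
    linear_combination -(1 - 𝕔 v * 𝕏) * mk_pow_mul_one_sub w -
      (1 - 𝕔 w * 𝕏) * mk_pow_mul_one_sub v + 𝕏 ^ 2 * hC
  have h := coeff_koebeTransform (PowerSeries.mk ((2 + w + v) ^ ·)) (k + 1)
  rw [hK] at h
  simpa [PowerSeries.coeff_one] using h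

/-- The generating function `∑ m, centralBinom m * q ^ m * X ^ m` of the powers of `q` weighted by
the central binomial coefficients. -/
def centralBinomSeries (q : K) : K⟦X⟧ := PowerSeries.mk fun m => m.centralBinom * q ^ m

lemma derivative_centralBinomSeries (q : K) :
    d⁄dX K (centralBinomSeries q) * (1 - 𝕔 (4 * q) * 𝕏) = 𝕔 (2 * q) * centralBinomSeries q := by
  have hrec (k : ℕ) : ((k + 1).centralBinom : K) * (k + 1) =
      2 * (2 * k + 1) * k.centralBinom := by
    rw [mul_comm]
    exact_mod_cast congrArg (Nat.cast : ℕ → K) <| Nat.succ_mul_centralBinom_succ k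
  rw [mul_sub, mul_one, mul_left_comm]
  ext k
  rw [map_sub, PowerSeries.coeff_C_mul, PowerSeries.coeff_C_mul, PowerSeries.coeff_derivative]
  cases k with
  | zero =>
    have h := hrec 0
    simp only [PowerSeries.coeff_zero_mul_X, centralBinomSeries, PowerSeries.coeff_mk,
      Nat.cast_zero, zero_add, Nat.centralBinom_zero] at h ⊢
    linear_combination q * h
  | succ k =>
    have h := hrec (k + 1)
    rw [PowerSeries.coeff_succ_mul_X, PowerSeries.coeff_derivative]
    simp only [centralBinomSeries, PowerSeries.coeff_mk]
    push_cast at h ⊢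
    linear_combination q ^ (k + 1 + 1) * h

variable [CharZero K]

lemma centralBinomSeries_sq_mul (q : K) :
    centralBinomSeries q ^ 2 * (1 - 𝕔 (4 * q) * 𝕏) = 1 := by
  refine PowerSeries.derivative.ext ?_ (by simp [centralBinomSeries])
  have h4 : 𝕔 (4 * q) = 2 * 𝕔 (2 * q) := by
    rw [show 4 * q = 2 * (2 * q) by ring, map_mul 𝕔 2 (2 * q), map_ofNat]
  have h := derivative_centralBinomSeries q
  rw [h4] at h ⊢
  simp only [Derivation.leibniz, Derivation.leibniz_pow, map_sub, smul_eq_mul, nsmul_eq_mul,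
    Derivation.map_one_eq_zero, PowerSeries.derivative_C, PowerSeries.derivative_X]
  rw [← map_ofNat 𝕔 2] at h ⊢
  simp only [PowerSeries.derivative_C]
  rw [map_ofNat] at h ⊢
  push_cast
  linear_combination 2 * centralBinomSeries q * h

lemma koebeTransform_centralBinomSeries_sq_mul (q : K) :
    koebeTransform (centralBinomSeries q) ^ 2 * ((1 + 𝕏) ^ 2 - 𝕔 (4 * q) * 𝕏) =
      (1 - 𝕏) ^ 2 := by
  have hne : (1 + 𝕏 : K⟦X⟧) ≠ 0 := by
    intro h0
    simpa using congrArg (PowerSeries.coeff 0) h0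
  refine mul_right_cancel₀ hne ?_
  linear_combination ((1 + 𝕏) ^ 2 - 𝕔 (4 * q) * 𝕏) * koebeTransform_sq (centralBinomSeries q) +
    (1 - 𝕏) * koebeTransform_mul_eq (centralBinomSeries_sq_mul q)

lemma eq_of_sq_eq_sq_of_constantCoeff_eq_one {F G : K⟦X⟧} (h : F ^ 2 = G ^ 2)
    (hF : PowerSeries.constantCoeff F = 1) (hG : PowerSeries.constantCoeff G = 1) : F = G := by
  refine (sq_eq_sq_iff_eq_or_eq_neg.1 h).resolve_right fun hneg => ?_
  have h1 := congrArg PowerSeries.constantCoeff hneg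
  rw [map_neg, hF, hG] at h1
  norm_num at h1

lemma koebeTransform_centralBinomSeries_mul (c d : K) :
    koebeTransform (centralBinomSeries (1 - c * d)) *
      (1 - 𝕏 - 2 * (𝕔 c * (𝕏 * schurFixedPoint c d))) = 1 - 𝕏 := by
  have hconst :
      PowerSeries.constantCoeff (koebeTransform (centralBinomSeries (1 - c * d))) = 1 := by
    rw [← PowerSeries.coeff_zero_eq_constantCoeff_apply, coeff_koebeTransform]
    simp [centralBinomSeries, koebeCoeff]
  refine eq_of_sq_eq_sq_of_constantCoeff_eq_one ?_ (by simp [hconst]) (by simp)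
  have hq : 𝕔 (4 * (1 - c * d)) = 4 - 4 * (𝕔 c * 𝕔 d) := by
    rw [map_mul, map_sub, map_mul, map_one, map_ofNat]
    ring
  have h := koebeTransform_centralBinomSeries_sq_mul (1 - c * d)
  rw [hq] at h
  linear_combination h - 4 * koebeTransform (centralBinomSeries (1 - c * d)) ^ 2 * 𝕔 c * 𝕏 *
    schurFixedPoint_eq c d

lemma X_mul_stepLogDeriv_schurFixedPoint_mul (c d : K) :
    𝕏 * stepLogDeriv c (schurFixedPoint c d) *
      (1 - 𝕏 - 2 * (𝕔 c * (𝕏 * schurFixedPoint c d))) = 𝕔 c * (𝕏 * schurFixedPoint c d) := by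
  have hstep := stepLogDeriv_mul c (schurFixedPoint c d)
  set u := 𝕔 c * (𝕏 * schurFixedPoint c d) with hu
  have hquad : u = 𝕏 * u - 𝕏 * 𝕔 (c * d) + u ^ 2 := by
    rw [hu, map_mul]
    linear_combination 𝕔 c * 𝕏 * schurFixedPoint_eq c d
  have hderiv : d⁄dX K u = u + 𝕏 * d⁄dX K u - 𝕔 (c * d) + 2 * u * d⁄dX K u := by
    have h := congrArg (d⁄dX K) hquad
    simp only [map_add, map_sub, Derivation.leibniz, Derivation.leibniz_pow, smul_eq_mul,
      PowerSeries.derivative_X, nsmul_eq_mul, PowerSeries.derivative_C] at h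
    push_cast at h
    linear_combination h
  have hne : 1 - u ≠ 0 := by
    intro h0
    simpa [hu] using congrArg (PowerSeries.coeff 0) h0
  refine mul_right_cancel₀ hne ?_
  linear_combination 𝕏 * (1 - 𝕏 - 2 * u) * hstep + 𝕏 * hderiv - hquad

lemma coeff_succ_koebeTransform_centralBinomSeries (c d : K) (k : ℕ) :
    PowerSeries.coeff (k + 1) (koebeTransform (centralBinomSeries (1 - c * d))) =
      2 * PowerSeries.coeff k (stepLogDeriv c (schurFixedPoint c d)) := by
  have h : koebeTransform (centralBinomSeries (1 - c * d)) =
      1 + 𝕏 * (𝕔 2 * stepLogDeriv c (schurFixedPoint c d)) := by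
    have hne : 1 - 𝕏 - 2 * (𝕔 c * (𝕏 * schurFixedPoint c d)) ≠ 0 := by
      intro h0
      simpa using congrArg (PowerSeries.coeff 0) h0
    refine mul_right_cancel₀ hne ?_
    rw [map_ofNat]
    linear_combination koebeTransform_centralBinomSeries_mul c d -
      2 * X_mul_stepLogDeriv_schurFixedPoint_mul c d
  rw [h, map_add, PowerSeries.coeff_succ_X_mul, PowerSeries.coeff_C_mul]
  simp [PowerSeries.coeff_one]

end GeneratingFunction

section Averages

open scoped ProbabilityTheory

variable {E : Type*} [NormedAddCommGroup E] [NormedSpace ℝ E] {t : ℝ}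

lemma isProbabilityMeasure_cond_Icc (ht : 0 < t) :
    IsProbabilityMeasure (volume[|Set.Icc 0 t] : Measure ℝ) :=
  ProbabilityTheory.cond_isProbabilityMeasure_of_finite (by simp [ht]) (by simp)

lemma integral_cond_Icc (ht : 0 < t) (f : ℝ → E) :
    ∫ s, f s ∂volume[|Set.Icc 0 t] = t⁻¹ • ∫ s in (0 : ℝ)..t, f s := by
  rw [ProbabilityTheory.cond, integral_smul_measure, intervalIntegral.integral_of_le ht.le,
    integral_Icc_eq_integral_Ioc, Real.volume_Icc, sub_zero, ENNReal.toReal_inv,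
    ENNReal.toReal_ofReal ht.le]

lemma ae_pos_cond_Icc (t : ℝ) : ∀ᵐ s ∂volume[|Set.Icc 0 t], 0 < s := by
  have hne : ∀ᵐ s : ℝ ∂volume[|Set.Icc 0 t], s ≠ 0 :=
    ProbabilityTheory.cond_absolutelyContinuous.ae_le (Measure.ae_ne volume 0)
  filter_upwards [hne, ProbabilityTheory.ae_cond_mem measurableSet_Icc] with s hs0 hs
  exact hs.1.lt_of_ne' hs0

lemma sum_range_eq_integral_floor [CompleteSpace E] (x : ℕ → E) (n : ℕ) :
    ∑ i ∈ Finset.range n, x i = ∫ v in (0 : ℝ)..n, x ⌊v⌋₊ := by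
  have hle (i : ℕ) : (i : ℝ) ≤ ((i + 1 : ℕ) : ℝ) := Nat.cast_le.2 i.le_succ
  have hcongr (i : ℕ) : Set.EqOn (fun _ : ℝ => x i) (fun v : ℝ => x ⌊v⌋₊)
      (Set.Ioo (i : ℝ) ((i + 1 : ℕ) : ℝ)) := fun v hv =>
    congrArg x (Nat.floor_eq_on_Ico i v ⟨hv.1.le, by simpa using hv.2⟩).symm
  have hint (i : ℕ) : ∫ v in (i : ℝ)..((i + 1 : ℕ) : ℝ), x ⌊v⌋₊ = x i := by
    rw [intervalIntegral.integral_of_le (hle i), integral_Ioc_eq_integral_Ioo,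
      ← setIntegral_congr_fun measurableSet_Ioo (hcongr i)]
    simp
  have hii (i : ℕ) : IntervalIntegrable (fun v : ℝ => x ⌊v⌋₊) volume (i : ℝ)
      ((i + 1 : ℕ) : ℝ) := by
    rw [intervalIntegrable_iff_integrableOn_Ioo_of_le (hle i)]
    exact (integrableOn_const (C := x i) (by simp)).congr_fun (hcongr i) measurableSet_Ioo
  have h := intervalIntegral.sum_integral_adjacent_intervals (μ := volume)
    (f := fun v : ℝ => x ⌊v⌋₊) (a := fun i : ℕ => (i : ℝ)) (n := n) fun i _ => hii i
  simpa only [hint, Nat.cast_zero] using h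

lemma inv_smul_sum_range_eq_integral_floor [CompleteSpace E] (x : ℕ → E) {n : ℕ} (hn : n ≠ 0)
    (ht : 0 < t) :
    (n : ℝ)⁻¹ • ∑ i ∈ Finset.range n, x i = ∫ s, x ⌊s / t * n⌋₊ ∂volume[|Set.Icc 0 t] := by
  have hn' : (n : ℝ) / t ≠ 0 := div_ne_zero (Nat.cast_ne_zero.2 hn) ht.ne'
  have h := intervalIntegral.integral_comp_mul_left (a := 0) (b := t) (fun v : ℝ => x ⌊v⌋₊) hn'
  have hcomm (s : ℝ) : s / t * n = n / t * s := by ring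
  simp only [integral_cond_Icc ht, hcomm]
  rw [h, mul_zero, div_mul_cancel₀ _ ht.ne', ← sum_range_eq_integral_floor, smul_smul, inv_div,
    inv_mul_eq_div, div_div_cancel_left' ht.ne']

lemma tendsto_floor_div_mul_fst_ratioFilter (ht : 0 < t) {s : ℝ} (hs : 0 < s) :
    Tendsto (fun p : ℕ × ℕ => (⌊s / t * p.1⌋₊, p.2)) (ratioFilter t) (ratioFilter s) := by
  simpa only [div_mul_cancel₀ s ht.ne'] using
    tendsto_floor_mul_fst_ratioFilter (t := t) (div_pos hs ht)

lemma ratioTendsto_inv_smul_sum_range [CompleteSpace E] {x : ℕ → ℕ → E} {B : ℝ}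
    (hx : ∀ n N, ‖x n N‖ ≤ B) (ht : 0 < t) {L : ℝ → E}
    (hL : ∀ᵐ s ∂volume[|Set.Icc 0 t], RatioTendsto x s (L s)) :
    RatioTendsto (fun n N => (n : ℝ)⁻¹ • ∑ i ∈ Finset.range n, x i N) t
      (∫ s, L s ∂volume[|Set.Icc 0 t]) := by
  have := isProbabilityMeasure_cond_Icc ht
  rw [ratioTendsto_iff_tendsto]
  have hlim : Tendsto (fun p : ℕ × ℕ => ∫ s, x ⌊s / t * p.1⌋₊ p.2 ∂volume[|Set.Icc 0 t])
      (ratioFilter t) (𝓝 (∫ s, L s ∂volume[|Set.Icc 0 t])) := by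
    refine tendsto_integral_filter_of_dominated_convergence (fun _ => B)
      (Eventually.of_forall fun p => ?_) (Eventually.of_forall fun p => ae_of_all _ fun s => hx _ _)
      (integrable_const B) ?_
    · have hfloor : Measurable fun s : ℝ => ⌊s / t * p.1⌋₊ := by fun_prop
      exact (StronglyMeasurable.of_discrete (f := (x · p.2))).comp_measurable hfloor
        |>.aestronglyMeasurable
    · filter_upwards [hL, ae_pos_cond_Icc t] with s hs hpos
      exact (ratioTendsto_iff_tendsto.1 hs).comp (tendsto_floor_div_mul_fst_ratioFilter ht hpos)
  refine hlim.congr' ?_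
  filter_upwards [tendsto_fst_ratioFilter.eventually_ge_atTop 1] with p hp
  exact (inv_smul_sum_range_eq_integral_floor (x · p.2) (Nat.one_le_iff_ne_zero.1 hp) ht).symm

end Averages

section ArcMeasure

open scoped Real ProbabilityTheory

lemma map_withDensity_abs_deriv {s : Set ℝ} (hs : MeasurableSet s) {f f' : ℝ → ℝ}
    (hf' : ∀ x ∈ s, HasDerivWithinAt f (f' x) s x) (hf : Measurable f) (hinj : Set.InjOn f s)
    (g : ℝ → ℝ≥0∞) :
    ((volume.restrict s).withDensity fun x => ENNReal.ofReal |f' x| * g (f x)).map f =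
      (volume.restrict (f '' s)).withDensity g := by
  ext u hu
  rw [Measure.map_apply hf hu, withDensity_apply _ (hf hu), withDensity_apply _ hu,
    Measure.restrict_restrict hu, Measure.restrict_restrict (hf hu), Set.inter_comm u,
    ← Set.image_inter_preimage, Set.inter_comm]
  exact (lintegral_image_eq_lintegral_abs_deriv_mul (hs.inter (hf hu))
    (fun x hx => (hf' x hx.1).mono Set.inter_subset_left) (hinj.mono Set.inter_subset_left) g).symm

/-- The uniform probability measure on `(-π / 2, π / 2)`. -/
def angleMeasure : Measure ℝ := volume[|Set.Ioo (-(π / 2)) (π / 2)]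

lemma angleMeasure_eq_smul :
    angleMeasure = ENNReal.ofReal π⁻¹ • volume.restrict (Set.Ioo (-(π / 2)) (π / 2)) := by
  rw [angleMeasure, ProbabilityTheory.cond, Real.volume_Ioo, sub_neg_eq_add, add_halves,
    ENNReal.ofReal_inv_of_pos Real.pi_pos]

instance : IsProbabilityMeasure angleMeasure :=
  ProbabilityTheory.cond_isProbabilityMeasure_of_finite (by simp [Real.pi_pos]) (by simp)

lemma integral_angleMeasure {E : Type*} [NormedAddCommGroup E] [NormedSpace ℝ E] (F : ℝ → E) :
    ∫ φ, F φ ∂angleMeasure = π⁻¹ • ∫ φ in (-(π / 2))..(π / 2), F φ := by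
  rw [angleMeasure_eq_smul, integral_smul_measure, ENNReal.toReal_ofReal (by positivity),
    intervalIntegral.integral_of_le (by linarith [Real.pi_pos]), integral_Ioc_eq_integral_Ioo]

lemma prod_range_odd_div_even (n : ℕ) :
    ∏ i ∈ Finset.range n, (2 * (i : ℝ) + 1) / (2 * i + 2) = n.centralBinom / 4 ^ n := by
  induction n with
  | zero => simp
  | succ n ih =>
    have hrec : ((n : ℝ) + 1) * (n + 1).centralBinom = 2 * (2 * n + 1) * n.centralBinom := by
      exact_mod_cast Nat.succ_mul_centralBinom_succ n
    rw [Finset.prod_range_succ, ih]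
    field_simp
    linear_combination -2 * 4 ^ n * hrec

lemma integral_sin_sq_pow_angleMeasure (m : ℕ) :
    ∫ φ, (Real.sin φ ^ 2) ^ m ∂angleMeasure = m.centralBinom / 4 ^ m := by
  have hper : Function.Periodic (fun φ => Real.sin φ ^ (2 * m)) π := fun φ => by
    simp only [Real.sin_add_pi, pow_mul, neg_sq]
  have h := hper.intervalIntegral_add_eq (-(π / 2)) 0
  rw [zero_add, integral_sin_pow_even, prod_range_odd_div_even,
    show -(π / 2) + π = π / 2 by ring] at h
  simp only [integral_angleMeasure, ← pow_mul]
  rw [h, smul_eq_mul, inv_mul_cancel_left₀ Real.pi_ne_zero]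

/-- The angle `θ` with `cos (θ / 2) = b * sin φ`. For `b = cos (θ_a / 2)` and `φ` uniformly
distributed on `(-π / 2, π / 2)`, the point `e^{iθ}` has distribution `ν_a`. -/
def arcParam (b φ : ℝ) : ℝ := 2 * Real.arccos (b * Real.sin φ)

/-- The point `e^{iθ}` of the arc `Γ_a` with `cos (θ / 2) = √(1 - a ^ 2) * sin φ`. -/
def arcPoint (a φ : ℝ) : ℂ := Complex.exp (arcParam √(1 - a ^ 2) φ * Complex.I)

@[fun_prop]
lemma continuous_arcParam (b : ℝ) : Continuous (arcParam b) := by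
  unfold arcParam
  fun_prop

lemma continuous_uncurry_arcPoint : Continuous (Function.uncurry arcPoint) := by
  unfold arcPoint arcParam Function.uncurry
  fun_prop

@[fun_prop]
lemma continuous_arcPoint (a : ℝ) : Continuous (arcPoint a) := by
  unfold arcPoint
  fun_prop

lemma norm_arcPoint (a φ : ℝ) : ‖arcPoint a φ‖ = 1 := Complex.norm_exp_ofReal_mul_I _

lemma arcPoint_mul_conj (a φ : ℝ) : arcPoint a φ * conj (arcPoint a φ) = 1 := by
  rw [Complex.mul_conj', norm_arcPoint, Complex.ofReal_one, one_pow]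

lemma arcPoint_neg (a φ : ℝ) : arcPoint a (-φ) = conj (arcPoint a φ) := by
  rw [arcPoint, arcPoint, arcParam, Real.sin_neg, mul_neg, Real.arccos_neg, mul_sub,
    ← arcParam, ← Complex.exp_conj, map_mul, Complex.conj_ofReal, Complex.conj_I,
    Complex.ofReal_sub, sub_mul, mul_neg, sub_eq_neg_add]
  exact_mod_cast Complex.exp_periodic _

lemma mul_sin_mem_Icc {b : ℝ} (hb0 : 0 ≤ b) (hb1 : b ≤ 1) (φ : ℝ) :
    b * Real.sin φ ∈ Set.Icc (-1) 1 :=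
  ⟨by nlinarith [Real.neg_one_le_sin φ], by nlinarith [Real.sin_le_one φ]⟩

lemma cos_arcParam_div_two {b : ℝ} (hb0 : 0 ≤ b) (hb1 : b ≤ 1) (φ : ℝ) :
    Real.cos (arcParam b φ / 2) = b * Real.sin φ := by
  have h := mul_sin_mem_Icc hb0 hb1 φ
  rw [arcParam, mul_div_cancel_left₀ _ two_ne_zero, Real.cos_arccos h.1 h.2]

lemma two_add_arcPoint_add_conj {a : ℝ} (ha : a ^ 2 ≤ 1) (φ : ℝ) :
    2 + arcPoint a φ + conj (arcPoint a φ) =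
      ((4 * (1 - a ^ 2) * Real.sin φ ^ 2 : ℝ) : ℂ) := by
  have hcos := cos_arcParam_div_two (Real.sqrt_nonneg (1 - a ^ 2))
    (Real.sqrt_le_one.2 (by nlinarith)) φ
  rw [add_assoc, Complex.add_conj, arcPoint, Complex.exp_ofReal_mul_I_re,
    ← mul_div_cancel₀ (arcParam _ φ) two_ne_zero, Real.cos_two_mul, hcos, mul_pow,
    Real.sq_sqrt (by linarith)]
  push_cast
  ring

lemma integral_conj_arcPoint_pow (a : ℝ) (k : ℕ) :
    ∫ φ, conj (arcPoint a φ) ^ k ∂angleMeasure = ∫ φ, arcPoint a φ ^ k ∂angleMeasure := by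
  have h := intervalIntegral.integral_comp_neg (a := -(π / 2)) (b := π / 2)
    (fun φ => arcPoint a φ ^ k)
  simp only [arcPoint_neg, neg_neg] at h
  rw [integral_angleMeasure, integral_angleMeasure, h]

lemma integral_two_add_arcPoint_add_conj_pow {a : ℝ} (ha : a ^ 2 ≤ 1) (m : ℕ) :
    ∫ φ, (2 + arcPoint a φ + conj (arcPoint a φ)) ^ m ∂angleMeasure =
      PowerSeries.coeff m (centralBinomSeries ((1 - a ^ 2 : ℝ) : ℂ)) := by
  have h : ∫ φ, (4 * (1 - a ^ 2) * Real.sin φ ^ 2) ^ m ∂angleMeasure =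
      m.centralBinom * (1 - a ^ 2) ^ m := by
    simp only [mul_pow _ (Real.sin _ ^ 2)]
    rw [integral_const_mul, integral_sin_sq_pow_angleMeasure, mul_pow]
    field_simp
  simp only [two_add_arcPoint_add_conj ha, ← Complex.ofReal_pow]
  rw [integral_complex_ofReal, h, centralBinomSeries, PowerSeries.coeff_mk]
  push_cast
  rfl

lemma integrable_angleMeasure_of_norm_le {F : ℝ → ℂ} (hF : Continuous F) {B : ℝ}
    (hB : ∀ φ, ‖F φ‖ ≤ B) : Integrable F angleMeasure :=
  .of_bound hF.aestronglyMeasurable B (ae_of_all _ hB)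

lemma two_mul_integral_conj_arcPoint_pow {a : ℝ} (ha : a ^ 2 ≤ 1) (k : ℕ) :
    2 * ∫ φ, conj (arcPoint a φ) ^ (k + 1) ∂angleMeasure =
      PowerSeries.coeff (k + 1) (koebeTransform (centralBinomSeries ((1 - a ^ 2 : ℝ) : ℂ))) := by
  have hpow : Integrable (fun φ => arcPoint a φ ^ (k + 1)) angleMeasure :=
    integrable_angleMeasure_of_norm_le (B := 1) (by fun_prop) fun φ => by simp [norm_arcPoint]
  have hconj : Integrable (fun φ => conj (arcPoint a φ) ^ (k + 1)) angleMeasure :=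
    integrable_angleMeasure_of_norm_le (B := 1) (by fun_prop) fun φ => by simp [norm_arcPoint]
  have hadd (m : ℕ) : Integrable (fun φ => (2 + arcPoint a φ + conj (arcPoint a φ)) ^ m)
      angleMeasure :=
    integrable_angleMeasure_of_norm_le (B := (2 + 1 + 1) ^ m) (by fun_prop) fun φ => by
      rw [norm_pow]
      gcongr
      exact norm_add₃_le.trans (by simp [norm_arcPoint])
  calc 2 * ∫ φ, conj (arcPoint a φ) ^ (k + 1) ∂angleMeasure
      = ∫ φ, (arcPoint a φ ^ (k + 1) + conj (arcPoint a φ) ^ (k + 1)) ∂angleMeasure := by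
        rw [integral_add hpow hconj, ← integral_conj_arcPoint_pow, two_mul]
    _ = ∫ φ, ∑ m ∈ Finset.range (k + 2), (2 + arcPoint a φ + conj (arcPoint a φ)) ^ m *
          koebeCoeff ℂ (k + 1) m ∂angleMeasure := by
        simp only [pow_add_pow_eq_sum_koebeCoeff (arcPoint_mul_conj a _)]
    _ = _ := by
        rw [integral_finsetSum _ fun m _ => (hadd m).mul_const _, coeff_koebeTransform]
        simp only [integral_mul_const, integral_two_add_arcPoint_add_conj_pow ha]

lemma integral_conj_arcPoint_norm_pow {c : ℂ} (hc : ‖c‖ ≤ 1) (k : ℕ) :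
    ∫ φ, conj (arcPoint ‖c‖ φ) ^ (k + 1) ∂angleMeasure =
      PowerSeries.coeff k (stepLogDeriv c (schurFixedPoint c (conj c))) := by
  refine mul_left_cancel₀ (two_ne_zero (α := ℂ)) ?_
  rw [two_mul_integral_conj_arcPoint_pow (pow_le_one₀ (norm_nonneg c) hc), Complex.ofReal_sub,
    Complex.ofReal_one, Complex.ofReal_pow, ← Complex.mul_conj',
    coeff_succ_koebeTransform_centralBinomSeries]

lemma strictAntiOn_arcParam {b : ℝ} (hb0 : 0 < b) (hb1 : b ≤ 1) :
    StrictAntiOn (arcParam b) (Set.Icc (-(π / 2)) (π / 2)) := fun x hx y hy hxy =>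
  mul_lt_mul_of_pos_left (Real.strictAntiOn_arccos (mul_sin_mem_Icc hb0.le hb1 x)
    (mul_sin_mem_Icc hb0.le hb1 y)
    (mul_lt_mul_of_pos_left (Real.strictMonoOn_sin hx hy hxy) hb0)) two_pos

lemma image_arcParam {b : ℝ} (hb0 : 0 < b) (hb1 : b ≤ 1) :
    arcParam b '' Set.Ioo (-(π / 2)) (π / 2) =
      Set.Ioo (2 * Real.arccos b) (2 * π - 2 * Real.arccos b) := by
  have hpi : -(π / 2) ≤ π / 2 := by linarith [Real.pi_pos]
  rw [(continuous_arcParam b).continuousOn.image_Ioo_of_strictAntiOn hpi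
    (strictAntiOn_arcParam hb0 hb1)]
  simp only [arcParam, Real.sin_neg, Real.sin_pi_div_two, mul_neg, mul_one, Real.arccos_neg,
    mul_sub]

lemma hasDerivAt_arcParam {b φ : ℝ} (hb0 : 0 ≤ b) (hb1 : b ≤ 1)
    (hφ : φ ∈ Set.Ioo (-(π / 2)) (π / 2)) :
    HasDerivAt (arcParam b) (-(2 * (b * Real.cos φ) / Real.sin (arcParam b φ / 2))) φ := by
  have hs : (b * Real.sin φ) ^ 2 < 1 := by
    nlinarith [Real.sin_sq_add_cos_sq φ, pow_pos (Real.cos_pos_of_mem_Ioo hφ) 2,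
      pow_le_one₀ (n := 2) hb0 hb1, sq_nonneg (Real.sin φ)]
  have h1 : b * Real.sin φ ≠ -1 := fun h => by norm_num [h] at hs
  have h2 : b * Real.sin φ ≠ 1 := fun h => by norm_num [h] at hs
  refine (((Real.hasDerivAt_arccos h1 h2).comp φ
    ((Real.hasDerivAt_sin φ).const_mul b)).const_mul 2).congr_deriv ?_
  rw [arcParam, mul_div_cancel_left₀ _ two_ne_zero, Real.sin_arccos]
  ring

lemma sin_arcParam_div_two_pos {b φ : ℝ} (hb0 : 0 < b) (hb1 : b ≤ 1)
    (hφ : φ ∈ Set.Ioo (-(π / 2)) (π / 2)) : 0 < Real.sin (arcParam b φ / 2) := by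
  have h : arcParam b φ ∈ Set.Ioo _ _ := image_arcParam hb0 hb1 ▸ Set.mem_image_of_mem _ hφ
  have := Real.arccos_nonneg b
  exact Real.sin_pos_of_pos_of_lt_pi (by linarith [h.1]) (by linarith [h.2])

lemma abs_deriv_arcParam_mul_arcDensity {a φ : ℝ} (ha : a ^ 2 < 1)
    (hφ : φ ∈ Set.Ioo (-(π / 2)) (π / 2)) :
    |-(2 * (√(1 - a ^ 2) * Real.cos φ) / Real.sin (arcParam √(1 - a ^ 2) φ / 2))| *
      arcDensity a (arcParam √(1 - a ^ 2) φ) = π⁻¹ := by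
  have hb0 : 0 < √(1 - a ^ 2) := Real.sqrt_pos.2 (by linarith)
  have hb1 : √(1 - a ^ 2) ≤ 1 := Real.sqrt_le_one.2 (by nlinarith)
  rw [arcDensity, arcAngle, mul_div_cancel_left₀ _ two_ne_zero, Real.cos_arcsin,
    cos_arcParam_div_two hb0.le hb1]
  have hsin := sin_arcParam_div_two_pos hb0 hb1 hφ
  have hcos := Real.cos_pos_of_mem_Ioo hφ
  generalize √(1 - a ^ 2) = b at *
  have hsqrt : √(b ^ 2 - (b * Real.sin φ) ^ 2) = b * Real.cos φ := by
    rw [← Real.sqrt_sq (mul_pos hb0 hcos).le]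
    congr 1
    linear_combination -b ^ 2 * Real.sin_sq_add_cos_sq φ
  rw [hsqrt, abs_neg, abs_of_pos (by positivity)]
  field_simp

lemma withDensity_arcDensity_eq_map {a : ℝ} (ha0 : 0 ≤ a) (ha1 : a < 1) :
    (volume.restrict (Set.Icc (arcAngle a) (2 * π - arcAngle a))).withDensity
        (fun θ => ENNReal.ofReal (arcDensity a θ)) =
      angleMeasure.map (arcParam √(1 - a ^ 2)) := by
  have ha : a ^ 2 < 1 := by nlinarith
  have hb0 : 0 < √(1 - a ^ 2) := Real.sqrt_pos.2 (by linarith)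
  have hb1 : √(1 - a ^ 2) ≤ 1 := Real.sqrt_le_one.2 (by nlinarith)
  rw [Measure.restrict_congr_set Ioo_ae_eq_Icc.symm, arcAngle, Real.arcsin_eq_arccos ha0,
    ← image_arcParam hb0 hb1, ← map_withDensity_abs_deriv measurableSet_Ioo
      (fun φ hφ => (hasDerivAt_arcParam hb0.le hb1 hφ).hasDerivWithinAt)
      (continuous_arcParam _).measurable
      ((strictAntiOn_arcParam hb0 hb1).injOn.mono Set.Ioo_subset_Icc_self),
    angleMeasure_eq_smul, ← withDensity_const]
  congr 1
  refine withDensity_congr_ae ?_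
  filter_upwards [ae_restrict_mem measurableSet_Ioo] with φ hφ
  rw [← ENNReal.ofReal_mul (abs_nonneg _), abs_deriv_arcParam_mul_arcDensity ha hφ]

lemma arcMeasure_eq_map {a : ℝ} (ha0 : 0 ≤ a) (ha1 : a ≤ 1) :
    arcMeasure a = angleMeasure.map (arcPoint a) := by
  rcases ha1.eq_or_lt with rfl | ha1
  · have h : arcPoint 1 = fun _ => -1 := by
      ext φ
      simp [arcPoint, arcParam, mul_div_cancel₀]
    rw [arcMeasure, if_pos rfl, h, Measure.map_const, measure_univ, one_smul]
  · rw [arcMeasure, if_neg ha1.ne, withDensity_arcDensity_eq_map ha0 ha1,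
      Measure.map_map (by fun_prop) (by fun_prop)]
    rfl

/-- The family `a ↦ ν_a` as a Markov kernel. For `a ∉ [0, 1]`, its value is the distribution of
`arcPoint a` instead of `arcMeasure a`. -/
def arcKernel : ProbabilityTheory.Kernel ℝ ℂ :=
  (ProbabilityTheory.Kernel.id ×ₖ ProbabilityTheory.Kernel.const ℝ angleMeasure).map
    (Function.uncurry arcPoint)

instance : ProbabilityTheory.IsMarkovKernel arcKernel :=
  ProbabilityTheory.Kernel.IsMarkovKernel.map _ continuous_uncurry_arcPoint.measurable

lemma arcKernel_apply (a : ℝ) : arcKernel a = angleMeasure.map (arcPoint a) := by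
  rw [arcKernel, ProbabilityTheory.Kernel.map_apply _ continuous_uncurry_arcPoint.measurable,
    ProbabilityTheory.Kernel.prod_apply, ProbabilityTheory.Kernel.id_apply,
    ProbabilityTheory.Kernel.const_apply, Measure.dirac_prod,
    Measure.map_map continuous_uncurry_arcPoint.measurable (by fun_prop)]
  rfl

lemma ae_norm_eq_one_arcKernel (a : ℝ) : ∀ᵐ z ∂arcKernel a, ‖z‖ = 1 := by
  rw [arcKernel_apply, ae_map_iff (by fun_prop) (measurableSet_eq_fun (by fun_prop) (by fun_prop))]
  exact ae_of_all _ (norm_arcPoint a)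

lemma integral_conj_pow_arcKernel {c : ℂ} (hc : ‖c‖ ≤ 1) (k : ℕ) :
    ∫ z, conj z ^ (k + 1) ∂arcKernel ‖c‖ =
      PowerSeries.coeff k (stepLogDeriv c (schurFixedPoint c (conj c))) := by
  rw [arcKernel_apply, integral_map (by fun_prop) (by fun_prop), integral_conj_arcPoint_norm_pow hc]

variable {t : ℝ} {α : ℝ → ℂ}

lemma averageArcMeasure_eq_comp (ht : 0 < t) (hαm : AEMeasurable α volume[|Set.Icc 0 t])
    (hα : ∀ᵐ s ∂volume[|Set.Icc 0 t], ‖α s‖ ≤ 1) :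
    averageArcMeasure t α = arcKernel ∘ₘ (volume[|Set.Icc 0 t].map fun s => ‖α s‖) := by
  have hcond : ENNReal.ofReal t⁻¹ • volume.restrict (Set.Icc 0 t) = volume[|Set.Icc 0 t] := by
    rw [ProbabilityTheory.cond, Real.volume_Icc, sub_zero, ENNReal.ofReal_inv_of_pos ht]
  have hcongr : (fun s => arcMeasure ‖α s‖) =ᵐ[volume[|Set.Icc 0 t]] fun s => arcKernel ‖α s‖ := by
    filter_upwards [hα] with s hs
    rw [arcMeasure_eq_map (norm_nonneg _) hs, arcKernel_apply]
  rw [averageArcMeasure, ← Measure.bind_smul, hcond, Measure.bind_congr_right hcongr,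
    Measure.bind, Measure.bind,
    AEMeasurable.map_map_of_aemeasurable arcKernel.aemeasurable hαm.norm]
  rfl

lemma isProbabilityMeasure_averageArcMeasure (ht : 0 < t)
    (hαm : AEMeasurable α volume[|Set.Icc 0 t]) (hα : ∀ᵐ s ∂volume[|Set.Icc 0 t], ‖α s‖ ≤ 1) :
    IsProbabilityMeasure (averageArcMeasure t α) := by
  have := isProbabilityMeasure_cond_Icc ht
  have := Measure.isProbabilityMeasure_map hαm.norm
  rw [averageArcMeasure_eq_comp ht hαm hα]
  infer_instance

lemma ae_norm_eq_one_averageArcMeasure (ht : 0 < t)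
    (hαm : AEMeasurable α volume[|Set.Icc 0 t]) (hα : ∀ᵐ s ∂volume[|Set.Icc 0 t], ‖α s‖ ≤ 1) :
    ∀ᵐ z ∂averageArcMeasure t α, ‖z‖ = 1 := by
  rw [averageArcMeasure_eq_comp ht hαm hα]
  exact Measure.ae_comp_of_ae_ae (measurableSet_eq_fun measurable_norm measurable_const)
    (ae_of_all _ ae_norm_eq_one_arcKernel)

lemma integral_conj_pow_averageArcMeasure (ht : 0 < t)
    (hαm : AEMeasurable α volume[|Set.Icc 0 t]) (hα : ∀ᵐ s ∂volume[|Set.Icc 0 t], ‖α s‖ ≤ 1)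
    (k : ℕ) :
    ∫ z, conj z ^ (k + 1) ∂averageArcMeasure t α =
      ∫ s, PowerSeries.coeff k (stepLogDeriv (α s) (schurFixedPoint (α s) (conj (α s))))
        ∂volume[|Set.Icc 0 t] := by
  have := isProbabilityMeasure_averageArcMeasure ht hαm hα
  have hint : Integrable (fun z => conj z ^ (k + 1)) (averageArcMeasure t α) := by
    refine .of_bound (by fun_prop) 1 ?_
    filter_upwards [ae_norm_eq_one_averageArcMeasure ht hαm hα] with z hz
    simp [hz]
  rw [averageArcMeasure_eq_comp ht hαm hα, Measure.comp_eq_comp_const_apply] at hint ⊢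
  rw [ProbabilityTheory.Kernel.integral_comp hint, ProbabilityTheory.Kernel.const_apply,
    integral_map hαm.norm]
  · refine integral_congr_ae ?_
    filter_upwards [hα] with s hs using integral_conj_pow_arcKernel hs k
  · exact (StronglyMeasurable.integral_kernel
      (by fun_prop : Measurable _).stronglyMeasurable).aestronglyMeasurable

end ArcMeasure

section WeakConvergence

lemma exists_laurent_norm_sub_le {f : ℂ → ℂ} (hf : Continuous f) {ε : ℝ} (hε : 0 < ε) :
    ∃ c : ℤ →₀ ℂ, ∀ w : ℂ, ‖w‖ = 1 → ‖f w - c.sum fun i a => a * w ^ i‖ ≤ ε := by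
  have : Fact (0 < 2 * Real.pi) := ⟨Real.two_pi_pos⟩
  let g : C(AddCircle (2 * Real.pi), ℂ) := ⟨fun x => f x.toCircle, by fun_prop⟩
  have hg : g ∈ (Submodule.span ℂ (Set.range <| fourier (T := 2 * Real.pi))).topologicalClosure :=
    by rw [span_fourier_closure_eq_top]; trivial
  obtain ⟨p, hp, hgp⟩ := Metric.mem_closure_iff.1 hg ε hε
  obtain ⟨c, rfl⟩ := Finsupp.mem_span_range_iff_exists_finsupp.1 hp
  refine ⟨c, fun w hw => ?_⟩
  obtain ⟨x, rfl⟩ : ∃ x : AddCircle (2 * Real.pi), (x.toCircle : ℂ) = w := by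
    obtain ⟨x, hx⟩ := (AddCircle.homeomorphCircle (T := 2 * Real.pi) this.out.ne').surjective
      ⟨w, mem_sphere_zero_iff_norm.2 hw⟩
    exact ⟨x, by rw [← AddCircle.homeomorphCircle_apply this.out.ne', hx]⟩
  have hx := (ContinuousMap.dist_apply_le_dist x).trans hgp.le
  rw [dist_eq_norm] at hx
  simpa only [g, Finsupp.sum, ContinuousMap.coe_mk, ContinuousMap.sum_apply,
    ContinuousMap.smul_apply, fourier_apply, AddCircle.toCircle_zsmul, Circle.coe_zpow,
    smul_eq_mul] using hx

section Moments

variable {μ : Measure ℂ}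

lemma integral_conj_pow_eq_integral_zpow (hμ : ∀ᵐ w ∂μ, ‖w‖ = 1) (k : ℕ) :
    ∫ w, conj w ^ k ∂μ = ∫ w : ℂ, w ^ (-(k : ℤ)) ∂μ := by
  refine integral_congr_ae ?_
  filter_upwards [hμ] with w hw
  rw [zpow_neg, zpow_natCast, ← inv_pow, Complex.inv_eq_conj hw]

variable [IsFiniteMeasure μ]

lemma integrable_zpow_of_ae_norm_eq_one (hμ : ∀ᵐ w ∂μ, ‖w‖ = 1) (i : ℤ) :
    Integrable (fun w : ℂ => w ^ i) μ := by
  refine .of_bound (by fun_prop) 1 ?_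
  filter_upwards [hμ] with w hw
  rw [norm_zpow, hw, one_zpow]

lemma integral_laurent (hμ : ∀ᵐ w ∂μ, ‖w‖ = 1) (c : ℤ →₀ ℂ) :
    ∫ w, (c.sum fun i a => a * w ^ i) ∂μ = c.sum fun i a => a * ∫ w, w ^ i ∂μ := by
  simp only [Finsupp.sum]
  rw [integral_finsetSum _ fun i _ => (integrable_zpow_of_ae_norm_eq_one hμ i).const_mul _]
  simp only [integral_const_mul]

lemma norm_integral_sub_integral_laurent_le (hμ : ∀ᵐ w ∂μ, ‖w‖ = 1) {f : ℂ → ℂ}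
    (hf : Integrable f μ) {c : ℤ →₀ ℂ} {ε : ℝ}
    (hc : ∀ w : ℂ, ‖w‖ = 1 → ‖f w - c.sum fun i a => a * w ^ i‖ ≤ ε) :
    ‖∫ w, f w ∂μ - c.sum fun i a => a * ∫ w, w ^ i ∂μ‖ ≤ ε * μ.real Set.univ := by
  have hL : Integrable (fun w : ℂ => c.sum fun i a => a * w ^ i) μ :=
    integrable_finsetSum _ fun i _ => (integrable_zpow_of_ae_norm_eq_one hμ i).const_mul _
  rw [← integral_laurent hμ, ← integral_sub hf hL]
  refine norm_integral_le_of_norm_le_const ?_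
  filter_upwards [hμ] with w hw using hc w hw

end Moments

variable {ι : Type*} {l : Filter ι} {μ : ι → FiniteMeasure ℂ} {σ : FiniteMeasure ℂ}

lemma tendsto_integral_zpow_of_tendsto_integral_conj_pow
    (hμ : ∀ j, ∀ᵐ w ∂(μ j : Measure ℂ), ‖w‖ = 1) (hσ : ∀ᵐ w ∂(σ : Measure ℂ), ‖w‖ = 1)
    (hmom : ∀ k : ℕ, Tendsto (fun j => ∫ w, conj w ^ k ∂(μ j : Measure ℂ)) l
      (𝓝 (∫ w, conj w ^ k ∂(σ : Measure ℂ)))) (i : ℤ) :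
    Tendsto (fun j => ∫ w : ℂ, w ^ i ∂(μ j : Measure ℂ)) l
      (𝓝 (∫ w : ℂ, w ^ i ∂(σ : Measure ℂ))) := by
  obtain ⟨k, rfl | rfl⟩ := Int.eq_nat_or_neg i
  · have h := (Complex.continuous_conj.tendsto _).comp (hmom k)
    simpa only [Function.comp_def, ← integral_conj, map_pow, Complex.conj_conj,
      zpow_natCast] using h
  · simpa only [integral_conj_pow_eq_integral_zpow (hμ _),
      integral_conj_pow_eq_integral_zpow hσ] using hmom k

lemma tendsto_of_tendsto_integral_conj_pow
    (hμ : ∀ j, ∀ᵐ w ∂(μ j : Measure ℂ), ‖w‖ = 1) (hσ : ∀ᵐ w ∂(σ : Measure ℂ), ‖w‖ = 1)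
    (hmom : ∀ k : ℕ, Tendsto (fun j => ∫ w, conj w ^ k ∂(μ j : Measure ℂ)) l
      (𝓝 (∫ w, conj w ^ k ∂(σ : Measure ℂ)))) :
    Tendsto μ l (𝓝 σ) := by
  have hmass : Tendsto (fun j => (μ j : Measure ℂ).real Set.univ) l
      (𝓝 ((σ : Measure ℂ).real Set.univ)) := by
    have h := (Complex.continuous_re.tendsto _).comp (hmom 0)
    simpa [Function.comp_def] using h
  rw [FiniteMeasure.tendsto_iff_forall_integral_rclike_tendsto ℂ]
  intro f
  set M := (σ : Measure ℂ).real Set.univ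
  rw [Metric.tendsto_nhds]
  intro ε hε
  obtain ⟨δ, hδ, hδε⟩ : ∃ δ > 0, δ * M + 0 + δ * M < ε := by
    have hpos : 0 < 2 * M + 2 := by positivity
    refine ⟨ε / (2 * M + 2), div_pos hε hpos, ?_⟩
    rw [add_zero, ← mul_add, div_mul_eq_mul_div, div_lt_iff₀ hpos]
    exact mul_lt_mul_of_pos_left (by linarith) hε
  obtain ⟨c, hc⟩ := exists_laurent_norm_sub_le f.continuous hδ
  have hnear (ν : FiniteMeasure ℂ) (hν : ∀ᵐ w ∂(ν : Measure ℂ), ‖w‖ = 1) :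
      dist (∫ w, f w ∂(ν : Measure ℂ)) (c.sum fun i a => a * ∫ w, w ^ i ∂(ν : Measure ℂ)) ≤
        δ * (ν : Measure ℂ).real Set.univ :=
    (dist_eq_norm _ _).trans_le (norm_integral_sub_integral_laurent_le hν (f.integrable _) hc)
  have hlaurent : Tendsto (fun j => c.sum fun i a => a * ∫ w, w ^ i ∂(μ j : Measure ℂ)) l
      (𝓝 (c.sum fun i a => a * ∫ w, w ^ i ∂(σ : Measure ℂ))) :=
    tendsto_finsetSum _ fun i _ =>
      (tendsto_integral_zpow_of_tendsto_integral_conj_pow hμ hσ hmom i).const_mul _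
  have herr : Tendsto (fun j => δ * (μ j : Measure ℂ).real Set.univ +
      dist (c.sum fun i a => a * ∫ w, w ^ i ∂(μ j : Measure ℂ))
        (c.sum fun i a => a * ∫ w, w ^ i ∂(σ : Measure ℂ)) + δ * M) l
      (𝓝 (δ * M + 0 + δ * M)) :=
    ((hmass.const_mul _).add (tendsto_iff_dist_tendsto_zero.1 hlaurent)).add_const _
  filter_upwards [herr.eventually_lt_const hδε] with j hj
  refine ((dist_triangle4 _ _ _ _).trans (add_le_add_three (hnear _ (hμ j)) le_rfl ?_)).trans_lt hj
  rw [dist_comm]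
  exact hnear σ hσ

end WeakConvergence

section ZeroMeasure

lemma integrable_sum_diracMass (s : Multiset ℂ) (f : ℂ → ℂ) :
    Integrable f ((s.map diracMass).sum : FiniteMeasure ℂ) := by
  induction s using Multiset.induction_on with
  | empty => simp
  | cons z s ih =>
    rw [Multiset.map_cons, Multiset.sum_cons, FiniteMeasure.toMeasure_add]
    exact (integrable_dirac enorm_lt_top).add_measure ih

lemma integral_sum_diracMass (s : Multiset ℂ) (f : ℂ → ℂ) :
    ∫ z, f z ∂((s.map diracMass).sum : FiniteMeasure ℂ) = (s.map f).sum := by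
  induction s using Multiset.induction_on with
  | empty => simp
  | cons z s ih =>
    rw [Multiset.map_cons, Multiset.sum_cons, FiniteMeasure.toMeasure_add,
      integral_add_measure (μ := diracMass z) (integrable_dirac enorm_lt_top)
        (integrable_sum_diracMass s f), ih, Multiset.map_cons, Multiset.sum_cons]
    exact congrArg (· + _) (integral_dirac f z)

lemma ae_sum_diracMass {s : Multiset ℂ} {p : ℂ → Prop} (hp : ∀ z ∈ s, p z) :
    ∀ᵐ z ∂((s.map diracMass).sum : FiniteMeasure ℂ).toMeasure, p z := by
  induction s using Multiset.induction_on with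
  | empty => simp
  | cons z s ih =>
    rw [Multiset.forall_mem_cons] at hp
    rw [Multiset.map_cons, Multiset.sum_cons, FiniteMeasure.toMeasure_add, ae_add_measure_iff]
    refine ⟨?_, ih hp.2⟩
    change ∀ᵐ w ∂Measure.dirac z, p w
    rw [ae_dirac_eq]
    exact hp.1

lemma integral_popucZeroMeasure (a : ℕ → ℂ) (β : ℂ) (n : ℕ) (f : ℂ → ℂ) :
    ∫ z, f z ∂(popucZeroMeasure a β n : Measure ℂ) =
      (n : ℝ)⁻¹ • ((popuc a β n).roots.map f).sum := by
  rw [popucZeroMeasure, FiniteMeasure.toMeasure_smul, integral_smul_nnreal_measure,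
    integral_sum_diracMass, NNReal.smul_def, NNReal.coe_inv, NNReal.coe_natCast]

lemma integral_one_popucZeroMeasure (a : ℕ → ℂ) (β : ℂ) {n : ℕ} (hn : n ≠ 0) :
    ∫ _, (1 : ℂ) ∂(popucZeroMeasure a β n : Measure ℂ) = 1 := by
  rw [integral_popucZeroMeasure, popuc_eq_opuc, Multiset.map_const', card_roots_opuc,
    Multiset.sum_replicate, ← Nat.cast_smul_eq_nsmul ℝ, inv_smul_smul₀ (Nat.cast_ne_zero.2 hn)]

variable {a : ℕ → ℂ} {β : ℂ}

lemma norm_eq_one_of_mem_roots_popuc (ha : ∀ k, ‖a k‖ ≤ 1) (hβ : ‖β‖ = 1) {n : ℕ} {z : ℂ}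
    (hz : z ∈ (popuc a β n).roots) : ‖z‖ = 1 := by
  rw [popuc_eq_opuc] at hz
  cases n with
  | zero => simp [opuc] at hz
  | succ n =>
    refine norm_eq_one_of_isRoot_opuc (fun k hk => ?_) ?_ (isRoot_of_mem_roots hz)
    · rw [Nat.add_sub_cancel, Function.update_of_ne hk.ne]
      exact ha k
    · rw [Nat.add_sub_cancel, Function.update_self, hβ]

lemma ae_norm_eq_one_popucZeroMeasure (ha : ∀ k, ‖a k‖ ≤ 1) (hβ : ‖β‖ = 1) (n : ℕ) :
    ∀ᵐ z ∂(popucZeroMeasure a β n : Measure ℂ), ‖z‖ = 1 := by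
  rw [popucZeroMeasure, FiniteMeasure.toMeasure_smul]
  exact Measure.smul_absolutelyContinuous.ae_le
    (ae_sum_diracMass fun z hz => norm_eq_one_of_mem_roots_popuc ha hβ hz)

lemma schurRatio_congr {a b : ℕ → ℂ} {n : ℕ} (h : ∀ k < n, a k = b k) :
    schurRatio a n = schurRatio b n := by
  rw [schurRatio, schurRatio, opucStar, opucStar, opuc_congr h]

lemma norm_integral_conj_pow_popucZeroMeasure_sub_le (ha : ∀ i, ‖a i‖ ≤ 1) (hβ : ‖β‖ = 1)
    (n k : ℕ) :
    ‖∫ z, conj z ^ (k + 1) ∂(popucZeroMeasure a β n : Measure ℂ) - (n : ℝ)⁻¹ •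
      ∑ i ∈ Finset.range n, PowerSeries.coeff k (stepLogDeriv (a i) (schurRatio a i))‖ ≤
        (stepBound k + stepBound k) / n := by
  rw [integral_popucZeroMeasure, popuc_eq_opuc, sum_conj_pow_roots_opuc]
  cases n with
  | zero => simp
  | succ n =>
    rw [Nat.add_sub_cancel]
    set b := Function.update a n β
    have hb (i : ℕ) : ‖b i‖ ≤ 1 := by
      rcases eq_or_ne i n with rfl | hi
      · rw [show b i = β from Function.update_self _ _ _, hβ]
      · rw [show b i = a i from Function.update_of_ne hi _ _]
        exact ha i
    have hstep (i : ℕ) (hi : i ∈ Finset.range n) :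
        PowerSeries.coeff k (stepLogDeriv (b i) (schurRatio b i)) =
          PowerSeries.coeff k (stepLogDeriv (a i) (schurRatio a i)) := by
      have hba (j : ℕ) (hj : j < n) : b j = a j := Function.update_of_ne hj.ne _ _
      rw [Finset.mem_range] at hi
      rw [hba i hi, schurRatio_congr fun j hj => hba j (hj.trans hi)]
    rw [← smul_sub, Finset.sum_range_succ, Finset.sum_range_succ, Finset.sum_congr rfl hstep,
      add_sub_add_left_eq_sub, norm_smul, norm_inv, Real.norm_natCast, inv_mul_eq_div]
    gcongr
    exact norm_sub_le_of_le (norm_coeff_stepLogDeriv_schurRatio_le hb k n)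
      (norm_coeff_stepLogDeriv_schurRatio_le ha k n)

end ZeroMeasure

section MomentLimits

open scoped ProbabilityTheory

variable {A : ℕ → ℕ → ℂ} {t : ℝ} {α : ℝ → ℂ}

lemma ae_norm_le_one_of_ae_ratioTendsto (hA : ∀ n N, ‖A n N‖ ≤ 1)
    (hlim : ∀ᵐ s ∂volume[|Set.Icc 0 t], RatioTendsto A s (α s)) :
    ∀ᵐ s ∂volume[|Set.Icc 0 t], ‖α s‖ ≤ 1 := by
  filter_upwards [hlim, ae_pos_cond_Icc t] with s hs hpos
  exact le_of_tendsto
    ((ratioTendsto_iff_tendsto.1 hs).comp (tendsto_floor_mul_ratioFilter hpos)).norm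
    (Eventually.of_forall fun _ => hA _ _)

lemma aemeasurable_of_ae_ratioTendsto
    (hlim : ∀ᵐ s ∂volume[|Set.Icc 0 t], RatioTendsto A s (α s)) :
    AEMeasurable α volume[|Set.Icc 0 t] := by
  refine aemeasurable_of_tendsto_metrizable_ae atTop
    (f := fun (j : ℕ) (s : ℝ) => A ⌊s * j⌋₊ j) (fun j => ?_) ?_
  · have hfloor : Measurable fun s : ℝ => ⌊s * j⌋₊ := by fun_prop
    exact ((Measurable.of_discrete (f := (A · j))).comp hfloor).aemeasurable
  · filter_upwards [hlim, ae_pos_cond_Icc t] with s hs hpos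
    exact (ratioTendsto_iff_tendsto.1 hs).comp (tendsto_floor_mul_ratioFilter hpos)

variable {β : ℕ → ℕ → ℂ}

lemma ratioTendsto_integral_conj_pow_succ_popucZeroMeasure (hA : ∀ n N, ‖A n N‖ ≤ 1)
    (hβ : ∀ n N, ‖β n N‖ = 1) (ht : 0 < t)
    (hlim : ∀ᵐ s ∂volume[|Set.Icc 0 t], RatioTendsto A s (α s)) (k : ℕ) :
    RatioTendsto
      (fun n N => ∫ z, conj z ^ (k + 1) ∂(popucZeroMeasure (A · N) (β n N) n : Measure ℂ)) t
      (∫ s, PowerSeries.coeff k (stepLogDeriv (α s) (schurFixedPoint (α s) (conj (α s))))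
        ∂volume[|Set.Icc 0 t]) := by
  have hsteps := ratioTendsto_inv_smul_sum_range
    (x := fun n N => PowerSeries.coeff k (stepLogDeriv (A n N) (schurRatio (A · N) n)))
    (fun n N => norm_coeff_stepLogDeriv_schurRatio_le (hA · N) k n) ht <| by
      filter_upwards [hlim] with s hs
      exact ratioTendsto_iff_tendsto.2 (tendsto_coeff_stepLogDeriv_schurRatio hs k)
  rw [ratioTendsto_iff_tendsto] at hsteps ⊢
  refine hsteps.congr_dist (squeeze_zero (fun _ => dist_nonneg) (fun p => ?_)
    ((tendsto_const_div_atTop_nhds_zero_nat (stepBound k + stepBound k)).comp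
      tendsto_fst_ratioFilter))
  rw [dist_comm, dist_eq_norm]
  exact norm_integral_conj_pow_popucZeroMeasure_sub_le (hA · p.2) (hβ p.1 p.2) p.1 k

lemma ratioTendsto_integral_one_popucZeroMeasure (A : ℕ → ℕ → ℂ) (β : ℕ → ℕ → ℂ) (t : ℝ) :
    RatioTendsto (fun n N => ∫ _, (1 : ℂ) ∂(popucZeroMeasure (A · N) (β n N) n : Measure ℂ)) t
      1 := by
  rw [ratioTendsto_iff_tendsto]
  refine tendsto_const_nhds.congr' ?_
  filter_upwards [tendsto_fst_ratioFilter.eventually_ge_atTop 1] with p hp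
  exact (integral_one_popucZeroMeasure _ _ (Nat.one_le_iff_ne_zero.1 hp)).symm

lemma ratioTendsto_integral_conj_pow_popucZeroMeasure (hA : ∀ n N, ‖A n N‖ ≤ 1)
    (hβ : ∀ n N, ‖β n N‖ = 1) (ht : 0 < t)
    (hlim : ∀ᵐ s ∂volume[|Set.Icc 0 t], RatioTendsto A s (α s)) (k : ℕ) :
    RatioTendsto (fun n N => ∫ z, conj z ^ k ∂(popucZeroMeasure (A · N) (β n N) n : Measure ℂ)) t
      (∫ z, conj z ^ k ∂averageArcMeasure t α) := by
  have hα := ae_norm_le_one_of_ae_ratioTendsto hA hlim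
  have hαm := aemeasurable_of_ae_ratioTendsto hlim
  cases k with
  | zero =>
    have := isProbabilityMeasure_averageArcMeasure ht hαm hα
    simpa only [pow_zero, integral_const (1 : ℂ) (μ := averageArcMeasure t α), probReal_univ,
      one_smul] using ratioTendsto_integral_one_popucZeroMeasure A β t
  | succ k =>
    rw [integral_conj_pow_averageArcMeasure ht hαm hα]
    exact ratioTendsto_integral_conj_pow_succ_popucZeroMeasure hA hβ ht hlim k

end MomentLimits

end VaryingPOPUC

open scoped ProbabilityTheory in
open VaryingPOPUC in
theorem theorem4p1_general {t : ℝ} (ht : 0 < t) {α : ℝ → ℂ} {A : ℕ → ℕ → ℂ}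
    (hA : ∀ n N, ‖A n N‖ ≤ 1)
    (hlim : ∀ᵐ s ∂(volume.restrict (Set.Icc 0 t)), RatioTendsto A s (α s)) :
    ∃ σ : ProbabilityMeasure ℂ,
      (σ : Measure ℂ) = averageArcMeasure t α ∧
      ∀ β : ℕ → ℕ → ℂ, (∀ n N, ‖β n N‖ = 1) →
        RatioTendsto (fun n N => popucZeroMeasure (fun k => A k N) (β n N) n) t
          σ.toFiniteMeasure := by
  replace hlim : ∀ᵐ s ∂volume[|Set.Icc 0 t], RatioTendsto A s (α s) :=
    Measure.smul_absolutelyContinuous.ae_le hlim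
  have hα := ae_norm_le_one_of_ae_ratioTendsto hA hlim
  have hαm := aemeasurable_of_ae_ratioTendsto hlim
  have hprob := isProbabilityMeasure_averageArcMeasure ht hαm hα
  refine ⟨⟨averageArcMeasure t α, hprob⟩, rfl, fun β hβ => ?_⟩
  exact ratioTendsto_iff_tendsto.2 (tendsto_of_tendsto_integral_conj_pow
    (fun p => ae_norm_eq_one_popucZeroMeasure (hA · p.2) (hβ p.1 p.2) p.1)
    (ae_norm_eq_one_averageArcMeasure ht hαm hα) fun k => ratioTendsto_iff_tendsto.1
      (ratioTendsto_integral_conj_pow_popucZeroMeasure hA hβ ht hlim k))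

theorem theorem4p1 (t : ℝ) (ht : 0 < t) (α : ℝ → ℂ)
    (hα_meas : NullMeasurable α (volume.restrict (Set.Icc 0 t)))
    (hα : ∀ s ∈ Set.Icc 0 t, ‖α s‖ ≤ 1)
    (A : ℕ → ℕ → ℂ) (hA : ∀ n N, ‖A n N‖ < 1)
    (hlim : ∀ᵐ s ∂(volume.restrict (Set.Icc 0 t)), VaryingPOPUC.RatioTendsto A s (α s)) :
    ∃ σ : ProbabilityMeasure ℂ,
      (σ : Measure ℂ) = VaryingPOPUC.averageArcMeasure t α ∧
      ∀ β : ℂ, ‖β‖ = 1 →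
        VaryingPOPUC.RatioTendsto
          (fun n N => VaryingPOPUC.popucZeroMeasure (fun k => A k N) β n) t
          σ.toFiniteMeasure := by
  obtain ⟨σ, hσ, h⟩ := theorem4p1_general ht (fun n N => (hA n N).le) hlim
  exact ⟨σ, hσ, fun β hβ => h (fun _ _ => β) fun _ _ => hβ⟩

end
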